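/- All spaces are $k$-spaces (a subset is closed if its preimage under every continuous map from a compact Hausdorff space is closed), and mapping spaces carry the $k$-ification of the compact-open topology. An \emph{h-graph} is a space with the homotopy type of a finite CW complex of dimension at most $1$. A map $f\colon X\to Y$ of h-graphs is an \emph{h-embedding} if there is a commutative square \[\begin{array}{ccc} A & \to & X\\ \downarrow & & \downarrow f\\ B & \to & Y\end{array}\] with $B$ an h-graph and $A$ of the homotopy type of a finite set, such that the induced map from the double mapping cylinder of $B\leftarrow A\to X$ to $Y$ is a homotopy equivalence. An \emph{h-graph cobordism} $S_0\colon X ⇸ Y$ between h-graphs $X$ and $Y$ consists of an h-graph $S_0$ and maps $X\xrightarrow{i}S_0\xleftarrow{j}Y$ such that $j$ is an h-embedding and $(i,j)\colon X\sqcup Y\to S_0$ is a closed cofibration. Its \emph{homotopy automorphism monoid} $\mathrm{hAut}(S_0)$ is the topological monoid, under composition, of homotopy equivalences $S_0\to S_0$ that fix $X\sqcup Y$ pointwise, topologized as a subspace (in $k$-spaces) of the space of maps $S_0\to S_0$. \textbf{Proposition.} Let $S_0\colon X ⇸ Y$ be an h-graph cobordism in which $X\sqcup Y$ meets every path component of $S_0$.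 Then every path component of $\mathrm{hAut}(S_0)$ is contractible. Moreover, the set $\pi_0\,\mathrm{hAut}(S_0)$ of path components is discrete in the quotient topology, and the canonical map $\mathrm{hAut}(S_0)\to\pi_0\,\mathrm{hAut}(S_0)$ is a homotopy equivalence. -/

import Mathlib

open scoped unitInterval ContinuousMap

universe u

namespace HGraph

/-- A continuous map is a homotopy equivalence if it has a homotopy inverse. -/
def IsHomotopyEquiv {X Y : Type u} [TopologicalSpace X] [TopologicalSpace Y] (f : C(X, Y)) : Prop :=
  ∃ e : X ≃ₕ Y, e.toFun = f

/-- An h-graph: a k-space (the standing convention for all spaces here; `CompactlyGeneratedSpace`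
tests against all continuous maps from compact Hausdorff spaces) that has the homotopy type of a
finite CW complex of dimension at most `1`. -/
def IsHGraph (X : Type u) [TopologicalSpace X] : Prop :=
  CompactlyGeneratedSpace X ∧
    ∃ (G : Type u) (_ : TopologicalSpace G) (_ : T2Space G)
      (_ : Topology.CWComplex (Set.univ : Set G)),
      Topology.CWComplex.Finite (Set.univ : Set G) ∧
      (∀ n, 2 ≤ n → IsEmpty (Topology.RelCWComplex.cell (Set.univ : Set G) n)) ∧
      Nonempty (X ≃ₕ G)

/-- A k-space with the homotopy type of a finite (discrete) set. -/
def HasFiniteSetType (A : Type u) [TopologicalSpace A] : Prop :=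
  CompactlyGeneratedSpace A ∧ ∃ n : ℕ, Nonempty (A ≃ₕ Fin n)

section Cylinder

variable {A B X Y : Type u} [TopologicalSpace A] [TopologicalSpace B] [TopologicalSpace X]
  [TopologicalSpace Y]

/-- The gluing relation of the double mapping cylinder on `B ⊔ (A × I) ⊔ X`: the end `(a, 0)` is
glued to `p a` and the end `(a, 1)` to `q a`. -/
inductive CylinderRel (p : C(A, B)) (q : C(A, X)) : B ⊕ (A × I) ⊕ X → B ⊕ (A × I) ⊕ X → Prop
  | left (a : A) : CylinderRel p q (Sum.inr (Sum.inl (a, 0))) (Sum.inl (p a))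
  | right (a : A) : CylinderRel p q (Sum.inr (Sum.inl (a, 1))) (Sum.inr (Sum.inr (q a)))

/-- The double mapping cylinder of `B ← A → X`, with the quotient topology. (Quotients and
disjoint unions of k-spaces, and products of k-spaces with the interval, are again k-spaces.) -/
def DoubleMappingCylinder (p : C(A, B)) (q : C(A, X)) : Type u :=
  Quot (CylinderRel p q)

instance (p : C(A, B)) (q : C(A, X)) : TopologicalSpace (DoubleMappingCylinder p q) :=
  inferInstanceAs (TopologicalSpace (Quot (CylinderRel p q)))

/-- The map from the double mapping cylinder of `B ← A → X` to `Y` that a commutative square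
induces: it is constant along the cylinder direction. -/
def cylinderMap (p : C(A, B)) (q : C(A, X)) (r : C(B, Y)) (f : C(X, Y))
    (comm : ∀ a, f (q a) = r (p a)) : C(DoubleMappingCylinder p q, Y) where
  toFun := Quot.lift (Sum.elim r (Sum.elim (fun z : A × I => r (p z.1)) f)) (by
    rintro _ _ (a | a)
    · rfl
    · exact (comm a).symm)
  continuous_toFun := by
    refine continuous_quot_lift _ ?_
    fun_prop

/-- A commutative square
```
  A --q--> X
  |p       |f
  v        v
  B --r--> Y
```
is a homotopy cofibre square if the map from the double mapping cylinder of `B ← A → X` to `Y`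
is a homotopy equivalence. -/
def IsHomotopyCofibreSquare (p : C(A, B)) (q : C(A, X)) (r : C(B, Y)) (f : C(X, Y)) : Prop :=
  ∃ comm : ∀ a, f (q a) = r (p a), IsHomotopyEquiv (cylinderMap p q r f comm)

/-- `f : X → Y` is an h-embedding if it is the right-hand side of a homotopy cofibre square whose
left-hand side goes from a space with the homotopy type of a finite set to an h-graph. -/
def IsHEmbedding (f : C(X, Y)) : Prop :=
  ∃ (A B : Type u) (_ : TopologicalSpace A) (_ : TopologicalSpace B)
    (p : C(A, B)) (q : C(A, X)) (r : C(B, Y)),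
    HasFiniteSetType A ∧ IsHGraph B ∧ IsHomotopyCofibreSquare p q r f

/-- A closed cofibration of k-spaces: a closed embedding with the homotopy extension property
with respect to all k-spaces `T`. -/
def IsClosedCofibration (f : C(A, X)) : Prop :=
  Topology.IsClosedEmbedding f ∧
    ∀ (T : Type u) [TopologicalSpace T] [CompactlyGeneratedSpace T] (g : C(X, T))
      (H : C(A × I, T)), (∀ a, H (a, 0) = g (f a)) →
      ∃ G : C(X × I, T), (∀ x, G (x, 0) = g x) ∧ ∀ a t, G (f a, t) = H (a, t)

/-- The map `(i, j) : X ⊔ Y → S` with components `i` and `j`. -/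
def sumMap {S : Type u} [TopologicalSpace S] (i : C(X, S)) (j : C(Y, S)) : C(X ⊕ Y, S) where
  toFun := Sum.elim i j
  continuous_toFun := by fun_prop

end Cylinder

/-- An h-graph cobordism `S` from `X` to `Y`: a zig-zag `X → S ← Y` of h-graphs. -/
structure Cobordism (X Y S : Type u) [TopologicalSpace X] [TopologicalSpace Y]
    [TopologicalSpace S] where
  isHGraph_source : IsHGraph X
  isHGraph_target : IsHGraph Y
  isHGraph_total : IsHGraph S
  i : C(X, S)
  j : C(Y, S)
  isHEmbedding_j : IsHEmbedding j
  isClosedCofibration : IsClosedCofibration (sumMap i j)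

section HAut

variable {X Y S : Type u} [TopologicalSpace X] [TopologicalSpace Y] [TopologicalSpace S]

/-- The underlying set of the homotopy automorphism monoid: homotopy equivalences `S → S` that fix
`X ⊔ Y` pointwise. -/
def hAutSet (c : Cobordism X Y S) : Set C(S, S) :=
  {f | IsHomotopyEquiv f ∧ ∀ z : X ⊕ Y, f (sumMap c.i c.j z) = sumMap c.i c.j z}

/-- The homotopy automorphism monoid of an h-graph cobordism. -/
def HAut (c : Cobordism X Y S) : Type u := hAutSet c

/-- The topology on `HAut c` as a subspace of the mapping space in the category of k-spaces: the
k-ification of the subspace topology of the compact-open topology on `C(S, S)`. -/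
instance (c : Cobordism X Y S) : TopologicalSpace (HAut c) :=
  TopologicalSpace.compactlyGenerated.{u} (hAutSet c)

/-- The monoid structure is given by composition. -/
instance (c : Cobordism X Y S) : Monoid (HAut c) where
  mul f g := ⟨f.1.comp g.1, by
    obtain ⟨_, ⟨e, rfl⟩, hf⟩ := f
    obtain ⟨_, ⟨e', rfl⟩, hg⟩ := g
    refine ⟨⟨e'.trans e, rfl⟩, fun z => ?_⟩
    simp only [ContinuousMap.comp_apply, hg, hf]⟩
  one := ⟨ContinuousMap.id S, ⟨ContinuousMap.HomotopyEquiv.refl S, rfl⟩, fun _ => rfl⟩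
  mul_assoc _ _ _ := rfl
  one_mul _ := rfl
  mul_one _ := rfl

end HAut

end HGraph

/-! The claim reduces to a deformation of `HAut c` onto the values of a locally constant map
(`Cobordism.exists_deformation`). The fibres of such a map are exactly the path components, and the
deformation contracts each of them; see `contractible_components_of_deformation`.

The deformation exists because graphs are aspherical in a canonical way. The total space `S` is a
homotopy retract of `C × R` with `C` finite discrete and `R` a rose. The universal cover of `R` is a
tree, where any two points are joined by a geodesic that is continuous in its ends, equivariant
under the free group, and constant when the ends coincide (`IsCombedCover`). Let `f` and `g` fix the
image `P` of `X ⊔ Y`. The maps `φ f` and `φ g` to `R` lift to the tree over the pullback of the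
cover. If the two lifts have the same equivariance and agree over `P` (`Matches`), the geodesics
between them descend to a homotopy from `φ f` to `φ g` that is constant on `P`.

Conjugating with the domination homotopy `h` gives a homotopy from `f` to `g` that over `P` runs
along `h` and back. This detour can be shrunk over `P`, and the retraction supplied by the
cofibration extends the shrinking to `S`, so that the result is relative to `P` (`relHomotopy`). No
step involves a choice that depends on `f` or `g`, so everything is continuous in families.

Whether two maps match is decided by finitely many elements of the free group: the effect on
generators, and the translations at one point of each path component of `P`. These are locally
constant in the map, so a representative for each value of the invariant gives the end of the
deformation. -/

namespace HGraph

/-! ### Tree distances and the word metric of a free group. -/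

/-- The combinatorial distance function of a simplicial tree. -/
structure IsTreeDist {V : Type*} (d : V → V → ℕ) : Prop where
  self : ∀ u, d u u = 0
  eq_of_zero : ∀ {u v}, d u v = 0 → u = v
  comm : ∀ u v, d u v = d v u
  triangle : ∀ u v w, d u w ≤ d u v + d v w
  -- `adj` makes the graph bipartite and `closer_unique` allows one neighbour towards `u` only;
  -- together they exclude cycles.
  adj : ∀ {v w} u, d v w = 1 → d u w = d u v + 1 ∨ d u v = d u w + 1
  closer_unique : ∀ {u v w w'}, d v w = 1 → d v w' = 1 → d u w < d u v → d u w' < d u v → w = w'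
  exists_closer : ∀ {u v}, u ≠ v → ∃ w, d v w = 1 ∧ d u v = d u w + 1

section WordMetric

variable {α : Type*} [DecidableEq α]

/-- The word metric of a free group. -/
def wordDist (u v : FreeGroup α) : ℕ := (u⁻¹ * v).norm

lemma wordDist_mul_left (g u v : FreeGroup α) : wordDist (g * u) (g * v) = wordDist u v := by
  simp [wordDist, mul_assoc]

lemma exists_letter_of_norm_eq_one {a : FreeGroup α} (ha : a.norm = 1) :
    ∃ x : α × Bool, a = FreeGroup.mk [x] := by
  obtain ⟨x, hx⟩ := List.length_eq_one_iff.mp ha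
  exact ⟨x, by rw [← hx, FreeGroup.mk_toWord]⟩

lemma norm_letter (x : α × Bool) : (FreeGroup.mk [x]).norm = 1 := by
  simp [FreeGroup.norm, FreeGroup.toWord_mk]

omit [DecidableEq α] in
lemma mk_letter_inv (x : α × Bool) : (FreeGroup.mk [x])⁻¹ = FreeGroup.mk [(x.1, !x.2)] := by
  simp [FreeGroup.inv_mk, FreeGroup.invRev]

/-- Multiplying a word on the left by the inverse of a letter either cancels the first letter or
makes the word longer. -/
lemma letter_inv_mul (x : α × Bool) (u : FreeGroup α) :
    (∃ l, u.toWord = x :: l ∧ ((FreeGroup.mk [x])⁻¹ * u).toWord = l) ∨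
      ((FreeGroup.mk [x])⁻¹ * u).norm = u.norm + 1 := by
  have key : ((FreeGroup.mk [x])⁻¹ * u).toWord =
      FreeGroup.reduce ((x.1, !x.2) :: u.toWord) := by
    rw [mk_letter_inv, FreeGroup.toWord_mul, FreeGroup.toWord_mk, FreeGroup.reduce_singleton]
    rfl
  rw [FreeGroup.norm, key, FreeGroup.reduce.cons, FreeGroup.reduce_toWord]
  rcases h : u.toWord with _ | ⟨y, l⟩
  · right; simp [FreeGroup.norm, h]
  · by_cases hxy : x.1 = y.1 ∧ (!x.2) = (!y.2)
    · left
      obtain ⟨h1, h2⟩ := hxy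
      have : x = y := Prod.ext h1 (by simpa using h2)
      subst this
      exact ⟨l, rfl, by simp⟩
    · right
      have hxy' : ¬ (x.1 = y.1 ∧ x.2 = y.2) := by simpa using hxy
      simp [FreeGroup.norm, h, hxy']

/-- By left invariance the distances from `u` to `v` and to `v * x` are the lengths of `v⁻¹ * u` and
`x⁻¹ * (v⁻¹ * u)`. Hence the only neighbour of `v` closer to `u` is given by the first letter of the
reduced word of `v⁻¹ * u`. -/
lemma isTreeDist_wordDist : IsTreeDist (wordDist (α := α)) := by
  have hcomm : ∀ u v : FreeGroup α, wordDist u v = wordDist v u := fun u v => by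
    rw [wordDist, wordDist, ← FreeGroup.norm_inv_eq]; simp
  have hstep : ∀ {v w : FreeGroup α} (u), wordDist v w = 1 → ∃ x : α × Bool,
      w = v * FreeGroup.mk [x] ∧ wordDist u v = (v⁻¹ * u).norm ∧
        wordDist u w = ((FreeGroup.mk [x])⁻¹ * (v⁻¹ * u)).norm := by
    intro v w u hvw
    obtain ⟨x, hx⟩ := exists_letter_of_norm_eq_one hvw
    have : w = v * FreeGroup.mk [x] := by rw [← hx]; simp
    exact ⟨x, this, hcomm u v, by rw [hcomm, this, wordDist]; simp [mul_assoc]⟩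
  refine ⟨fun u => by simp [wordDist], fun {u v} h => ?_, hcomm, fun u v w => ?_, ?_, ?_, ?_⟩
  · exact (inv_mul_eq_one.mp (FreeGroup.norm_eq_zero.mp h))
  · simpa [wordDist, mul_assoc] using FreeGroup.norm_mul_le (u⁻¹ * v) (v⁻¹ * w)
  · intro v w u hvw
    obtain ⟨x, -, h1, h2⟩ := hstep u hvw
    rw [h1, h2]
    rcases letter_inv_mul x (v⁻¹ * u) with ⟨l, h3, h4⟩ | h3
    · right; rw [FreeGroup.norm, FreeGroup.norm, h3, h4]; rfl
    · left; exact h3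
  · intro u v w w' hw hw' h h'
    obtain ⟨x, hx, h1, h2⟩ := hstep u hw
    obtain ⟨y, hy, h3, h4⟩ := hstep u hw'
    rw [h1, h2] at h
    rw [h3, h4] at h'
    rcases letter_inv_mul x (v⁻¹ * u) with ⟨l, h5, -⟩ | h5
    · rcases letter_inv_mul y (v⁻¹ * u) with ⟨l', h6, -⟩ | h6
      · rw [hx, hy]
        rw [h5] at h6
        simp_all
      · omega
    · omega
  · intro u v huv
    rcases h : (v⁻¹ * u).toWord with _ | ⟨x, l⟩
    · exact absurd (inv_mul_eq_one.mp (FreeGroup.toWord_eq_nil_iff.mp h)).symm huv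
    · have h1 : wordDist v (v * FreeGroup.mk [x]) = 1 := by
        simp [wordDist, norm_letter]
      refine ⟨v * FreeGroup.mk [x], h1, ?_⟩
      rw [hcomm, hcomm u, wordDist, wordDist]
      rcases letter_inv_mul x (v⁻¹ * u) with ⟨l', h5, h6⟩ | h5
      · rw [mul_inv_rev, mul_assoc, FreeGroup.norm, FreeGroup.norm, h5, h6]; rfl
      · exfalso
        have h6 : FreeGroup.mk [x] * FreeGroup.mk l = v⁻¹ * u := by
          rw [FreeGroup.mul_mk, List.singleton_append, ← h, FreeGroup.mk_toWord]
        rw [← h6, inv_mul_cancel_left, h6, FreeGroup.norm, FreeGroup.norm, h] at h5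
        have := FreeGroup.norm_mk_le (L₁ := l)
        simp [FreeGroup.norm] at this h5
        omega

end WordMetric

/-! ### Geodesics in a tree and the shape of distance functions along them. -/

section Geodesics

variable {V : Type*} {d : V → V → ℕ}

/-- A vertex geodesic of length `n`. -/
def IsGeod (d : V → V → ℕ) (c : ℕ → V) (n : ℕ) : Prop :=
  ∀ i ≤ n, ∀ j ≤ n, (d (c i) (c j) : ℤ) = |(i : ℤ) - j|

lemma IsTreeDist.exists_geod (hd : IsTreeDist d) (n : ℕ) : ∀ p q, d p q = n →
    ∃ c : ℕ → V, c 0 = p ∧ c n = q ∧ IsGeod d c n := by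
  induction n with
  | zero =>
    intro p q h
    refine ⟨fun _ => p, rfl, hd.eq_of_zero h, fun i hi j hj => ?_⟩
    obtain rfl : i = 0 := by omega
    obtain rfl : j = 0 := by omega
    simp [hd.self]
  | succ n ih =>
    intro p q h
    have hpq : p ≠ q := by rintro rfl; simp [hd.self] at h
    obtain ⟨w, hw1, hw2⟩ := hd.exists_closer hpq
    obtain ⟨c, hc0, hcn, hc⟩ := ih p w (by omega)
    have hlast : ∀ i ≤ n, (d (c i) q : ℤ) = (n : ℤ) + 1 - i := by
      intro i hi
      have h1 := hc i hi n le_rfl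
      have h2 := hc 0 (by omega) i hi
      rw [hcn] at h1
      rw [hc0] at h2
      have h3 := hd.triangle (c i) w q
      have h4 := hd.triangle p (c i) q
      have h5 := hd.comm w q
      have h6 : |(i : ℤ) - n| = n - i := by rw [abs_of_nonpos] <;> omega
      have h7 : |((0 : ℕ) : ℤ) - i| = i := by rw [abs_of_nonpos] <;> push_cast <;> omega
      omega
    refine ⟨fun i => if i ≤ n then c i else q, by simp [hc0], by simp, fun i hi j hj => ?_⟩
    by_cases h1 : i ≤ n <;> by_cases h2 : j ≤ n
    · simp [h1, h2, hc i h1 j h2]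
    · obtain rfl : j = n + 1 := by omega
      simp only [h1, h2, if_true, if_false, hlast i h1]
      rw [abs_of_nonpos] <;> push_cast <;> omega
    · obtain rfl : i = n + 1 := by omega
      simp only [h1, h2, if_true, if_false]
      rw [hd.comm, hlast j h2, abs_of_nonneg] <;> push_cast <;> omega
    · obtain rfl : j = n + 1 := by omega
      obtain rfl : i = n + 1 := by omega
      simp [hd.self]

lemma IsGeod.ne {c : ℕ → V} {n : ℕ} (hc : IsGeod d c n) (hd : IsTreeDist d) {i j : ℕ}
    (hi : i ≤ n) (hj : j ≤ n) (hij : i ≠ j) : c i ≠ c j := by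
  intro h
  have := hc i hi j hj
  rw [h, hd.self] at this
  have := abs_eq_zero.mp this.symm
  omega

lemma IsGeod.adj {c : ℕ → V} {n k : ℕ} (hc : IsGeod d c n) (hk : k < n) :
    d (c k) (c (k + 1)) = 1 := by
  have := hc k hk.le (k + 1) hk
  rw [abs_of_nonpos] at this <;> push_cast at * <;> omega

/-- A walk with steps `±1` and no strict local maximum descends, turns at most once, and then
ascends. -/
lemma exists_gate_of_no_peak (D : ℕ → ℕ) (n : ℕ)
    (hstep : ∀ k < n, D (k + 1) = D k + 1 ∨ D k = D (k + 1) + 1)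
    (hpeak : ∀ k, k + 2 ≤ n → ¬ (D k < D (k + 1) ∧ D (k + 2) < D (k + 1))) :
    ∃ m ≤ n, ∃ h : ℕ, ∀ k ≤ n, (D k : ℤ) = h + |(k : ℤ) - m| := by
  induction n with
  | zero => exact ⟨0, le_rfl, D 0, fun k hk => by obtain rfl : k = 0 := by omega
                                                  simp⟩
  | succ n ih =>
    obtain ⟨m, hm, h, hD⟩ := ih (fun k hk => hstep k (by omega)) fun k hk => hpeak k (by omega)
    have hn := hD n le_rfl
    rcases hstep n (by omega) with h1 | h1
    · refine ⟨m, by omega, h, fun k hk => ?_⟩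
      rcases Nat.lt_or_ge n k with h2 | h2
      · obtain rfl : k = n + 1 := by omega
        rw [abs_of_nonneg (by omega)] at hn ⊢
        push_cast
        omega
      · exact hD k h2
    -- A final descent after an earlier ascent would create a peak, so the walk has only descended
    -- so far.
    · obtain rfl : m = n := by
        by_contra hmn
        obtain ⟨k, rfl⟩ : ∃ k, n = k + 1 := ⟨n - 1, by omega⟩
        have h3 := hD k (by omega)
        rw [abs_of_nonneg (by omega)] at hn h3
        have h4 : D (k + 2) = D (k + 1 + 1) := rfl
        exact hpeak k (by omega) ⟨by omega, by omega⟩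
      refine ⟨m + 1, le_rfl, D (m + 1), fun k hk => ?_⟩
      rcases Nat.lt_or_ge m k with h2 | h2
      · obtain rfl : k = m + 1 := by omega
        simp
      · have h3 := hD k h2
        rw [abs_of_nonpos (by omega)] at h3 ⊢
        simp at hn
        push_cast
        omega

/-- The distance to a vertex along a geodesic has the shape of the absolute value. -/
lemma IsTreeDist.exists_gate (hd : IsTreeDist d) {c : ℕ → V} {n : ℕ} (hc : IsGeod d c n) (u : V) :
    ∃ m ≤ n, ∃ h : ℕ, ∀ k ≤ n, (d u (c k) : ℤ) = h + |(k : ℤ) - m| := by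
  refine exists_gate_of_no_peak (fun k => d u (c k)) n (fun k hk => hd.adj u (hc.adj hk)) ?_
  rintro k hk ⟨h1, h2⟩
  -- At a peak both neighbours on the geodesic are closer to `u`, hence equal, which a geodesic
  -- forbids.
  refine hc.ne hd (i := k) (j := k + 2) (by omega) hk (by omega)
    (hd.closer_unique (v := c (k + 1)) ?_ (hc.adj (by omega)) h1 h2)
  rw [hd.comm]; exact hc.adj (by omega)

/-- The distance from the point at distance `t` from `v` on the edge from `v` to `w`. -/
noncomputable def edgeFun (d : V → V → ℕ) (v w : V) (t : ℝ) (u : V) : ℝ :=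
  min (d u v + t) (d u w + 1 - t)

lemma edgeFun_comm (v w : V) (t : ℝ) : edgeFun d v w t = edgeFun d w v (1 - t) := by
  ext u
  rw [edgeFun, edgeFun, min_comm]
  congr 1 <;> ring

/-- The gate `m` is a vertex, so `|x - m|` is affine on every edge, and the minimum in `edgeFun` is
attained through the end nearer to the gate. -/
lemma IsTreeDist.edgeFun_geod (hd : IsTreeDist d) {c : ℕ → V} {n : ℕ} (hc : IsGeod d c n) (u : V) :
    ∃ m ≤ n, ∃ h : ℕ, ∀ k < n, ∀ t : ℝ, 0 ≤ t → t ≤ 1 →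
      edgeFun d (c k) (c (k + 1)) t u = h + |(k + t) - m| := by
  obtain ⟨m, hm, h, hD⟩ := hd.exists_gate hc u
  refine ⟨m, hm, h, fun k hk t ht0 ht1 => ?_⟩
  have h1 : (d u (c k) : ℝ) = h + |(k : ℝ) - m| := by exact_mod_cast hD k hk.le
  have h2 : (d u (c (k + 1)) : ℝ) = h + |((k + 1 : ℕ) : ℝ) - m| := by exact_mod_cast hD (k + 1) hk
  rw [edgeFun, h1, h2]
  push_cast
  rcases le_or_gt m k with hmk | hmk
  · have : (m : ℝ) ≤ k := by exact_mod_cast hmk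
    rw [abs_of_nonneg (by linarith), abs_of_nonneg (by linarith), abs_of_nonneg (by linarith),
      min_eq_left] <;> linarith
  · have : (k : ℝ) + 1 ≤ m := by exact_mod_cast hmk
    rw [abs_of_nonpos (by linarith), abs_of_nonpos (by linarith), abs_of_nonpos (by linarith),
      min_eq_right] <;> linarith

/-- The points of the tree, each given by its distances from the vertices. -/
def treeSet (d : V → V → ℕ) : Set (V → ℝ) :=
  {f | ∃ v w t, d v w = 1 ∧ 0 ≤ t ∧ t ≤ 1 ∧ f = edgeFun d v w t}

/-- Any two edges lie at the ends of a geodesic. -/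
lemma IsTreeDist.exists_geod_of_mem (hd : IsTreeDist d) {f g : V → ℝ} (hf : f ∈ treeSet d)
    (hg : g ∈ treeSet d) : ∃ (c : ℕ → V) (n : ℕ) (a b : ℝ), IsGeod d c (n + 1) ∧
      0 ≤ a ∧ a ≤ 1 ∧ 0 ≤ b ∧ b ≤ 1 ∧ f = edgeFun d (c 0) (c 1) a ∧
      g = edgeFun d (c n) (c (n + 1)) b := by
  -- If `p'` is closer to `q` and `q'` is closer to `p`, the geodesic from `p` to `q` must start and
  -- end with the given edges, by `closer_unique`.
  have key : ∀ p p' q q' : V, d p p' = 1 → d q' q = 1 → d p' q + 1 = d p q →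
      d p q' + 1 = d p q → ∃ (c : ℕ → V) (n : ℕ), IsGeod d c (n + 1) ∧ c 0 = p ∧ c 1 = p' ∧
        c n = q' ∧ c (n + 1) = q := by
    intro p p' q q' hp hq h1 h2
    obtain ⟨c, hc0, hcn, hc⟩ := hd.exists_geod (d p' q + 1) p q h1.symm
    have e1 := hc 1 (by omega) _ le_rfl
    have e2 := hc 0 (by omega) (d p' q) (by omega)
    have e3 := hc.adj (k := 0) (by omega)
    have e4 := hc.adj (k := d p' q) (by omega)
    rw [abs_of_nonpos (by push_cast; omega)] at e1 e2
    rw [hcn] at e1 e4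
    rw [hc0] at e2 e3
    push_cast at e1 e2
    refine ⟨c, d p' q, hc, hc0, ?_, ?_, hcn⟩
    · refine hd.closer_unique (u := q) (v := p) e3 hp ?_ ?_
      · rw [hd.comm q, hd.comm q]; omega
      · rw [hd.comm q, hd.comm q]; omega
    · refine hd.closer_unique (u := p) (v := q) ?_ ?_ ?_ ?_
      · rw [hd.comm]; exact e4
      · rw [hd.comm]; exact hq
      · omega
      · omega
  obtain ⟨v, v', s, hv, hs0, hs1, rfl⟩ := hf
  obtain ⟨w, w', t, hw, ht0, ht1, rfl⟩ := hg
  have hv' : d v' v = 1 := by rw [hd.comm]; exact hv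
  have hw' : d w' w = 1 := by rw [hd.comm]; exact hw
  have a1 := hd.adj w hv
  have a2 := hd.adj w' hv
  have a3 := hd.adj v hw
  have a4 := hd.adj v' hw
  rw [hd.comm w, hd.comm w] at a1
  rw [hd.comm w', hd.comm w'] at a2
  -- The cases say which pair of ends of the two edges is farthest apart; an edge is reversed where
  -- needed.
  have cases4 : (d v' w' + 1 = d v w' ∧ d v w + 1 = d v w') ∨
      (d v w' + 1 = d v' w' ∧ d v' w + 1 = d v' w') ∨
      (d v' w + 1 = d v w ∧ d v w' + 1 = d v w) ∨
      (d v w + 1 = d v' w ∧ d v' w' + 1 = d v' w) := by omega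
  rcases cases4 with h | h | h | h
  · obtain ⟨c, n, hc, rfl, rfl, rfl, rfl⟩ := key v v' w' w hv hw h.1 h.2
    exact ⟨c, n, s, t, hc, hs0, hs1, ht0, ht1, rfl, rfl⟩
  · obtain ⟨c, n, hc, rfl, rfl, rfl, rfl⟩ := key v' v w' w hv' hw h.1 h.2
    exact ⟨c, n, 1 - s, t, hc, by linarith, by linarith, ht0, ht1, edgeFun_comm _ _ _, rfl⟩
  · obtain ⟨c, n, hc, rfl, rfl, rfl, rfl⟩ := key v v' w w' hv hw' h.1 h.2
    exact ⟨c, n, s, 1 - t, hc, hs0, hs1, by linarith, by linarith, rfl, edgeFun_comm _ _ _⟩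
  · obtain ⟨c, n, hc, rfl, rfl, rfl, rfl⟩ := key v' v w w' hv' hw' h.1 h.2
    exact ⟨c, n, 1 - s, 1 - t, hc, by linarith, by linarith, by linarith, by linarith,
      edgeFun_comm _ _ _, edgeFun_comm _ _ _⟩

/-- Any two points of the tree lie on a line, along which the distances from the vertices have the
shape of the absolute value. -/
lemma IsTreeDist.exists_line (hd : IsTreeDist d) {f g : V → ℝ} (hf : f ∈ treeSet d)
    (hg : g ∈ treeSet d) : ∃ (γ : ℝ → V → ℝ) (l a b : ℝ), 0 ≤ a ∧ a ≤ l ∧ 0 ≤ b ∧ b ≤ l ∧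
      f = γ a ∧ g = γ b ∧ (∀ r, 0 ≤ r → r ≤ l → γ r ∈ treeSet d) ∧
      (∀ u, ∃ m h : ℝ, ∀ r, 0 ≤ r → r ≤ l → γ r u = h + |r - m|) ∧ ∃ u, ∀ r, 0 ≤ r → r ≤ l →
        γ r u = r := by
  obtain ⟨c, n, a, b, hc, ha0, ha1, hb0, hb1, rfl, rfl⟩ := hd.exists_geod_of_mem hf hg
  have hn : (0 : ℝ) ≤ n := Nat.cast_nonneg n
  choose m hm h hmh using fun u => hd.edgeFun_geod hc u
  have hγ : ∀ k < n + 1, ∀ t : ℝ, 0 ≤ t → t ≤ 1 →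
      edgeFun d (c k) (c (k + 1)) t = fun u => h u + |(k + t) - m u| :=
    fun k hk t h0 h1 => funext fun u => hmh u k hk t h0 h1
  refine ⟨fun r u => h u + |r - m u|, n + 1, a, n + b, ha0, by linarith, by linarith, by linarith,
    ?_, hγ n (by omega) b hb0 hb1, ?_, fun u => ⟨m u, h u, fun r _ _ => rfl⟩, c 0, ?_⟩
  · simpa using hγ 0 (by omega) a ha0 ha1
  · intro r h0 h1
    obtain ⟨k, hk, hk0, hk1⟩ : ∃ k : ℕ, k < n + 1 ∧ (k : ℝ) ≤ r ∧ r ≤ k + 1 := by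
      rcases h1.lt_or_eq with h2 | rfl
      · refine ⟨⌊r⌋₊, ?_, Nat.floor_le h0, (Nat.lt_floor_add_one r).le⟩
        exact (Nat.floor_lt h0).mpr (by exact_mod_cast h2)
      · exact ⟨n, by omega, by linarith, le_rfl⟩
    refine ⟨c k, c (k + 1), r - k, hc.adj hk, by linarith, by linarith, ?_⟩
    rw [hγ k hk _ (by linarith) (by linarith)]
    simp
  -- At the first vertex the value for `r = 0` is `0`, which forces both constants `h` and `m` to
  -- vanish there.
  · intro r h0 h1
    have h2 := hmh (c 0) 0 (by omega) 0 le_rfl zero_le_one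
    have h3 : edgeFun d (c 0) (c (0 + 1)) 0 (c 0) = 0 := by
      rw [edgeFun, hd.self, hc.adj (by omega)]; norm_num
    rw [h3] at h2
    have h4 : (0 : ℝ) ≤ h (c 0) := Nat.cast_nonneg _
    have h5 := abs_nonneg (((0 : ℕ) : ℝ) + 0 - (m (c 0) : ℝ))
    have h6 : (h (c 0) : ℝ) = 0 := by linarith
    have h7 : (m (c 0) : ℝ) = 0 := by
      have : |((0 : ℕ) : ℝ) + 0 - (m (c 0) : ℝ)| = 0 := by linarith
      simpa using this
    simp only [h6, h7]
    rw [sub_zero, abs_of_nonneg h0, zero_add]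

end Geodesics

/-! ### The geometric realization as a metric space with geodesics. -/

section Metric

variable {V : Type*} {d : V → V → ℕ}

/-- The geometric realization of the tree with vertex set `V` and distance function `d`. -/
def Tree (d : V → V → ℕ) : Type _ := treeSet d

namespace Tree

instance : CoeFun (Tree d) (fun _ => V → ℝ) := ⟨Subtype.val⟩

lemma ext {x y : Tree d} (h : ∀ u, x u = y u) : x = y := Subtype.ext (funext h)

variable [hd : Fact (IsTreeDist d)]

lemma exists_line (x y : Tree d) : ∃ (γ : ℝ → V → ℝ) (l a b : ℝ), 0 ≤ a ∧ a ≤ l ∧ 0 ≤ b ∧ b ≤ l ∧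
      x.1 = γ a ∧ y.1 = γ b ∧ (∀ r, 0 ≤ r → r ≤ l → γ r ∈ treeSet d) ∧
      (∀ u, ∃ m h : ℝ, ∀ r, 0 ≤ r → r ≤ l → γ r u = h + |r - m|) ∧ ∃ u, ∀ r, 0 ≤ r → r ≤ l →
        γ r u = r :=
  hd.out.exists_line x.2 y.2

noncomputable instance : Dist (Tree d) := ⟨fun x y => ⨆ u, |x u - y u|⟩

/-- On a line through both points every vertex function is `1`-Lipschitz. Boundedness matters
because an unbounded real supremum takes the default value `0`. -/
lemma bddAbove (x y : Tree d) : BddAbove (Set.range fun u => |x u - y u|) := by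
  obtain ⟨γ, l, a, b, ha0, ha1, hb0, hb1, hx, hy, -, hm, -⟩ := exists_line x y
  refine ⟨|a - b|, ?_⟩
  rintro _ ⟨u, rfl⟩
  obtain ⟨m, h, hmh⟩ := hm u
  simp only [hx, hy, hmh a ha0 ha1, hmh b hb0 hb1]
  calc |h + |a - m| - (h + |b - m|)| = |(|a - m| - |b - m|)| := by ring_nf
    _ ≤ |(a - m) - (b - m)| := abs_abs_sub_abs_le _ _
    _ = |a - b| := by ring_nf

lemma abs_sub_le_dist (x y : Tree d) (u : V) : |x u - y u| ≤ dist x y :=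
  le_ciSup (bddAbove x y) u

omit hd in
lemma dist_le [Nonempty V] {x y : Tree d} {r : ℝ} (h : ∀ u, |x u - y u| ≤ r) : dist x y ≤ r :=
  ciSup_le h

omit hd in
lemma nonempty_of_tree (x : Tree d) : Nonempty V := by
  obtain ⟨_, v, -⟩ := x
  exact ⟨v⟩

noncomputable instance : MetricSpace (Tree d) where
  dist_self x := by
    have := nonempty_of_tree x
    exact le_antisymm (dist_le fun u => by simp)
      ((abs_nonneg _).trans (abs_sub_le_dist x x (Classical.arbitrary V)))
  dist_comm x y := by
    show (⨆ u, _) = ⨆ u, _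
    simp_rw [abs_sub_comm]
  dist_triangle x y z := by
    have := nonempty_of_tree x
    exact dist_le fun u => (abs_sub_le (x u) (y u) (z u)).trans
      (add_le_add (abs_sub_le_dist x y u) (abs_sub_le_dist y z u))
  eq_of_dist_eq_zero {x y} h := ext fun u => by
    have := abs_sub_le_dist x y u
    rw [h] at this
    exact sub_eq_zero.mp (abs_eq_zero.mp (le_antisymm this (abs_nonneg _)))

/-- The value at a vertex of the point at parameter `s` on the geodesic from `x` to `y`. -/
noncomputable def combFun (x y : Tree d) (s : ℝ) (u : V) : ℝ :=
  max (x u - s * dist x y) (y u - (1 - s) * dist x y)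

/-- On a line where `x` and `y` have parameters `a` and `b`, the distance is `|a - b|`. For `r`
between `a` and `b`, `|r - m|` is the larger of `|a - m| - |r - a|` and `|b - m| - |b - r|`. So the
formula is the point at parameter `(1 - s) * a + s * b`. -/
lemma combFun_mem (x y : Tree d) {s : ℝ} (h0 : 0 ≤ s) (h1 : s ≤ 1) :
    combFun x y s ∈ treeSet d := by
  have := nonempty_of_tree x
  obtain ⟨γ, l, a, b, ha0, ha1, hb0, hb1, hx, hy, hγ, hm, u, hu⟩ := exists_line x y
  have hdist : dist x y = |a - b| := by
    apply le_antisymm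
    · refine dist_le fun u => ?_
      obtain ⟨m, h, hmh⟩ := hm u
      simp only [hx, hy, hmh a ha0 ha1, hmh b hb0 hb1]
      calc |h + |a - m| - (h + |b - m|)| = |(|a - m| - |b - m|)| := by ring_nf
        _ ≤ |(a - m) - (b - m)| := abs_abs_sub_abs_le _ _
        _ = |a - b| := by ring_nf
    -- The vertex `u` at the start of the line sees the parameters themselves, which gives the lower
    -- bound.
    · have := abs_sub_le_dist x y u
      rwa [hx, hy, hu a ha0 ha1, hu b hb0 hb1] at this
  have hr0 : 0 ≤ (1 - s) * a + s * b := by nlinarith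
  have hr1 : (1 - s) * a + s * b ≤ l := by nlinarith
  convert hγ _ hr0 hr1 using 1
  funext u
  obtain ⟨m, h, hmh⟩ := hm u
  rw [combFun, hdist, hx, hy, hmh a ha0 ha1, hmh b hb0 hb1, hmh _ hr0 hr1]
  rcases le_total a b with hab | hab
  · rw [abs_of_nonpos (sub_nonpos.mpr hab)]
    have hA : a ≤ (1 - s) * a + s * b := by nlinarith
    have hB : (1 - s) * a + s * b ≤ b := by nlinarith
    apply le_antisymm
    · apply max_le <;> cases abs_cases (a - m) <;> cases abs_cases (b - m) <;>
        cases abs_cases ((1 - s) * a + s * b - m) <;> linarith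
    · rw [le_max_iff]
      rcases le_total m ((1 - s) * a + s * b) with hmr | hmr
      · right
        rw [abs_of_nonneg (sub_nonneg.mpr hmr), abs_of_nonneg (by linarith)]; linarith
      · left
        rw [abs_of_nonpos (sub_nonpos.mpr hmr), abs_of_nonpos (by linarith)]; linarith
  · rw [abs_of_nonneg (sub_nonneg.mpr hab)]
    have hA : (1 - s) * a + s * b ≤ a := by nlinarith
    have hB : b ≤ (1 - s) * a + s * b := by nlinarith
    apply le_antisymm
    · apply max_le <;> cases abs_cases (a - m) <;> cases abs_cases (b - m) <;>
        cases abs_cases ((1 - s) * a + s * b - m) <;> linarith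
    · rw [le_max_iff]
      rcases le_total m ((1 - s) * a + s * b) with hmr | hmr
      · left
        rw [abs_of_nonneg (sub_nonneg.mpr hmr), abs_of_nonneg (by linarith)]; linarith
      · right
        rw [abs_of_nonpos (sub_nonpos.mpr hmr), abs_of_nonpos (by linarith)]; linarith

/-- The geodesics of the tree. -/
noncomputable def comb (x y : Tree d) (s : I) : Tree d :=
  ⟨combFun x y s, combFun_mem x y s.2.1 s.2.2⟩

lemma comb_apply (x y : Tree d) (s : I) (u : V) : comb x y s u =
    max (x u - s * dist x y) (y u - (1 - s) * dist x y) := rfl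

lemma comb_zero (x y : Tree d) : comb x y 0 = x := ext fun u => by
  have := abs_le.mp (abs_sub_le_dist x y u)
  rw [comb_apply, max_eq_left] <;> simp
  linarith

lemma comb_one (x y : Tree d) : comb x y 1 = y := ext fun u => by
  have := abs_le.mp (abs_sub_le_dist x y u)
  rw [comb_apply, max_eq_right] <;> simp
  linarith

lemma comb_self (x : Tree d) (s : I) : comb x x s = x := ext fun u => by
  simp [comb_apply]

/-- Since `max` is `1`-Lipschitz, the change at each vertex is bounded by a quantity that does not
depend on the vertex. -/
lemma continuous_comb : Continuous fun p : Tree d × Tree d × I => comb p.1 p.2.1 p.2.2 := by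
  rw [continuous_iff_continuousAt]
  rintro ⟨x, y, s⟩
  have := nonempty_of_tree x
  rw [ContinuousAt, tendsto_iff_dist_tendsto_zero]
  have hlim : Filter.Tendsto (fun p : Tree d × Tree d × I => dist p.1 x + dist p.2.1 y +
      (|p.2.2 * dist p.1 p.2.1 - s * dist x y| +
        |(1 - p.2.2) * dist p.1 p.2.1 - (1 - s) * dist x y|)) (nhds (x, y, s)) (nhds 0) := by
    have : Continuous (fun p : Tree d × Tree d × I => dist p.1 x + dist p.2.1 y +
      (|p.2.2 * dist p.1 p.2.1 - s * dist x y| +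
        |(1 - p.2.2) * dist p.1 p.2.1 - (1 - s) * dist x y|)) := by fun_prop
    convert this.tendsto (x, y, s) using 2
    simp
  refine squeeze_zero (fun _ => dist_nonneg) (fun p => dist_le fun u => ?_) hlim
  rw [comb_apply, comb_apply]
  refine (abs_max_sub_max_le_max _ _ _ _).trans (max_le ?_ ?_)
  · calc _ = |(p.1 u - x u) - (p.2.2 * dist p.1 p.2.1 - s * dist x y)| := by ring_nf
      _ ≤ |p.1 u - x u| + |p.2.2 * dist p.1 p.2.1 - s * dist x y| := abs_sub _ _
      _ ≤ _ := by
        have h1 := abs_sub_le_dist p.1 x u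
        have h2 := dist_nonneg (x := p.2.1) (y := y)
        have h3 := abs_nonneg ((1 - p.2.2) * dist p.1 p.2.1 - (1 - s) * dist x y)
        linarith
  · calc _ = |(p.2.1 u - y u) - ((1 - p.2.2) * dist p.1 p.2.1 - (1 - s) * dist x y)| := by ring_nf
      _ ≤ |p.2.1 u - y u| + |(1 - p.2.2) * dist p.1 p.2.1 - (1 - s) * dist x y| := abs_sub _ _
      _ ≤ _ := by
        have h1 := abs_sub_le_dist p.2.1 y u
        have h2 := dist_nonneg (x := p.1) (y := x)
        have h3 := abs_nonneg (p.2.2 * dist p.1 p.2.1 - s * dist x y)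
        linarith

/-- The point at distance `t` from `v` on the edge from `v` to `w`. -/
noncomputable def edge {v w : V} (h : d v w = 1) (t : I) : Tree d :=
  ⟨edgeFun d v w t, v, w, t, h, t.2.1, t.2.2, rfl⟩

lemma continuous_edge {v w : V} (h : d v w = 1) : Continuous (edge (d := d) h) := by
  have : Nonempty V := ⟨v⟩
  refine LipschitzWith.continuous (K := 1) (LipschitzWith.of_dist_le_mul fun s t => ?_)
  rw [NNReal.coe_one, one_mul]
  refine dist_le fun u => ?_
  refine (abs_min_sub_min_le_max _ _ _ _).trans (max_le ?_ ?_) <;> rw [Subtype.dist_eq, Real.dist_eq]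
  · ring_nf; exact le_rfl
  · rw [abs_sub_comm]; ring_nf; exact le_rfl

end Tree

end Metric

/-! ### Combed covers: the Cayley tree over the rose. -/

/-- A covering with group `F` whose total space has an equivariant choice of paths between any two
points that is continuous and constant on the diagonal. -/
structure IsCombedCover {F T R : Type*} [Group F] [MulAction F T] [TopologicalSpace T]
    [TopologicalSpace R] (p : T → R) (comb : T → T → I → T) : Prop
    extends IsQuotientCoveringMap p F where
  continuous_comb : Continuous fun x : T × T × I => comb x.1 x.2.1 x.2.2
  comb_zero : ∀ x y, comb x y 0 = x
  comb_one : ∀ x y, comb x y 1 = y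
  comb_self : ∀ x s, comb x x s = x
  comb_smul : ∀ (g : F) x y s, comb (g • x) (g • y) s = g • comb x y s

section FreeTree

variable {α : Type u} [DecidableEq α]

instance : Fact (IsTreeDist (wordDist (α := α))) := ⟨isTreeDist_wordDist⟩

/-- The Cayley tree of a free group. -/
abbrev FreeTree (α : Type u) [DecidableEq α] := Tree (wordDist (α := α))

namespace FreeTree

lemma edgeFun_smul (g v w : FreeGroup α) (t : ℝ) (u : FreeGroup α) :
    edgeFun wordDist v w t (g⁻¹ * u) = edgeFun wordDist (g * v) (g * w) t u := by
  have h (v : FreeGroup α) : wordDist (g⁻¹ * u) v = wordDist u (g * v) := by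
    rw [← wordDist_mul_left g, mul_inv_cancel_left]
  rw [edgeFun, edgeFun, h, h]

instance : MulAction (FreeGroup α) (FreeTree α) where
  smul g x := ⟨fun u => x (g⁻¹ * u), by
    obtain ⟨_, v, w, t, h, h0, h1, rfl⟩ := x
    exact ⟨g * v, g * w, t, by rwa [wordDist_mul_left], h0, h1, funext (edgeFun_smul g v w t)⟩⟩
  one_smul x := Tree.ext fun u => by
    show x (1⁻¹ * u) = x u
    simp
  mul_smul g g' x := Tree.ext fun u => by
    show x ((g * g')⁻¹ * u) = x (g'⁻¹ * (g⁻¹ * u))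
    simp [mul_assoc]

lemma smul_apply (g : FreeGroup α) (x : FreeTree α) (u : FreeGroup α) :
    (g • x : FreeTree α) u = x (g⁻¹ * u) := rfl

lemma dist_smul (g : FreeGroup α) (x y : FreeTree α) : dist (g • x) (g • y) = dist x y :=
  (Equiv.mulLeft g⁻¹).iSup_congr fun _ => rfl

instance : ContinuousConstSMul (FreeGroup α) (FreeTree α) :=
  ⟨fun g => (Isometry.of_dist_eq (dist_smul g)).continuous⟩

lemma comb_smul (g : FreeGroup α) (x y : FreeTree α) (s : I) :
    Tree.comb (g • x) (g • y) s = g • Tree.comb x y s := Tree.ext fun u => by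
  rw [smul_apply, Tree.comb_apply, Tree.comb_apply, dist_smul, smul_apply, smul_apply]

lemma wordDist_pos {u v : FreeGroup α} (h : u ≠ v) : 1 ≤ wordDist u v :=
  Nat.one_le_iff_ne_zero.mpr fun h' => h (isTreeDist_wordDist.eq_of_zero h')

lemma wordDist_comm (u v : FreeGroup α) : wordDist u v = wordDist v u := isTreeDist_wordDist.comm u v

lemma wordDist_self (u : FreeGroup α) : wordDist u u = 0 := isTreeDist_wordDist.self u

/-- Let `v` be the nearer end of the edge of `x`, and `w` the other end. If `g⁻¹ * v` is not `w`,
the values of `x` and `g • x` at `v` differ by at least `1`. Otherwise `g⁻¹` shifts the edge along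
an axis, and `w` is a witness. -/
lemma one_le_dist_smul {g : FreeGroup α} (hg : g ≠ 1) (x : FreeTree α) : 1 ≤ dist x (g • x) := by
  have key : ∀ (v w : FreeGroup α) (t : ℝ), wordDist v w = 1 → 0 ≤ t → t ≤ 1 / 2 →
      x.1 = edgeFun wordDist v w t → 1 ≤ dist x (g • x) := by
    intro v w t hvw h0 h1 hx
    have hv : g⁻¹ * v ≠ v := by simpa using hg
    have hwv : wordDist w v = 1 := by rwa [wordDist_comm]
    by_cases hw : g⁻¹ * v = w
    · have h2 : wordDist (g⁻¹ * w) w = 1 := by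
        conv_lhs => rw [← hw]
        rw [wordDist_mul_left, hw]
        exact hwv
      have h3 : wordDist (g⁻¹ * w) v = 2 := by
        rcases isTreeDist_wordDist.adj (g⁻¹ * w) hwv with h | h
        · omega
        -- Here `g⁻¹` would invert the edge, so `g` would have order `2`; free groups are
        -- torsion-free.
        · exfalso
          have h4 : g⁻¹ * w = v := isTreeDist_wordDist.eq_of_zero (by omega)
          rw [← hw, ← mul_assoc, mul_eq_right, ← sq] at h4
          exact hg (by simpa using h4)
      refine le_trans ?_ (Tree.abs_sub_le_dist x (g • x) w)
      rw [smul_apply, hx, edgeFun, edgeFun, h2, h3, wordDist_self, hwv]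
      rw [min_eq_right (by push_cast; linarith), min_eq_right (by push_cast; linarith)]
      rw [abs_sub_comm]
      refine le_trans ?_ (le_abs_self _)
      push_cast; linarith
    · refine le_trans ?_ (Tree.abs_sub_le_dist x (g • x) v)
      have h2 : (1 : ℝ) ≤ wordDist (g⁻¹ * v) v := by exact_mod_cast wordDist_pos hv
      have h3 : (1 : ℝ) ≤ wordDist (g⁻¹ * v) w := by exact_mod_cast wordDist_pos hw
      rw [smul_apply, hx, edgeFun, edgeFun, wordDist_self, hvw, abs_sub_comm]
      refine le_trans ?_ (le_abs_self _)
      rw [min_eq_left (by push_cast; linarith : ((0 : ℕ) : ℝ) + t ≤ ((1 : ℕ) : ℝ) + 1 - t)]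
      have h5 : 1 + t ≤ min ((wordDist (g⁻¹ * v) v : ℝ) + t) (wordDist (g⁻¹ * v) w + 1 - t) :=
        le_min (by linarith) (by linarith)
      rw [Nat.cast_zero]
      linarith
  obtain ⟨v, w, t, hvw, h0, h1, hx⟩ := x.2
  rcases le_total t (1 / 2) with h | h
  · exact key v w t hvw h0 h hx
  · exact key w v (1 - t) (by rwa [wordDist_comm]) (by linarith) (by linarith)
      (by rw [hx, edgeFun_comm])

lemma wordDist_mul_of (w : FreeGroup α) (a : α) : wordDist w (w * FreeGroup.of a) = 1 := by
  simp [wordDist]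

/-- The point at distance `t` from `w` on the edge labelled `a` that starts at `w`. -/
noncomputable def edge (w : FreeGroup α) (a : α) (t : I) : FreeTree α :=
  Tree.edge (wordDist_mul_of w a) t

lemma continuous_edge (w : FreeGroup α) (a : α) : Continuous (edge w a) := Tree.continuous_edge (wordDist_mul_of w a)

lemma edge_apply (w : FreeGroup α) (a : α) (t : I) (u : FreeGroup α) :
    edge w a t u = min ((wordDist u w : ℝ) + t) (wordDist u (w * FreeGroup.of a) + 1 - t) := rfl

lemma smul_edge (g w : FreeGroup α) (a : α) (t : I) : g • edge w a t = edge (g * w) a t :=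
  Tree.ext fun u => by
    rw [smul_apply]
    exact (edgeFun_smul g w _ t u).trans (by rw [← mul_assoc]; rfl)

lemma exists_eq_edge (x : FreeTree α) : ∃ w a t, x = edge w a t := by
  obtain ⟨f, v, w, t, hvw, h0, h1, rfl⟩ := x
  obtain ⟨⟨a, b⟩, hx⟩ := exists_letter_of_norm_eq_one hvw
  cases b
  · have : v = w * FreeGroup.of a := by
      have : w = v * (FreeGroup.of a)⁻¹ := by
        rw [show (FreeGroup.of a)⁻¹ = FreeGroup.mk [(a, false)] from rfl, ← hx]; simp
      rw [this]; simp
    subst this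
    refine ⟨w, a, ⟨1 - t, by linarith, by linarith⟩, Subtype.ext ?_⟩
    exact edgeFun_comm _ _ _
  · have : w = v * FreeGroup.of a := by
      rw [show FreeGroup.of a = FreeGroup.mk [(a, true)] from rfl, ← hx]; simp
    subst this
    exact ⟨v, a, ⟨t, h0, h1⟩, rfl⟩

lemma edge_zero_apply (w : FreeGroup α) (a : α) (u : FreeGroup α) : edge w a 0 u = wordDist u w := by
  have h := isTreeDist_wordDist.adj u (wordDist_mul_of w a)
  have h' : (wordDist u w : ℝ) ≤ wordDist u (w * FreeGroup.of a) + 1 := by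
    exact_mod_cast (by omega : wordDist u w ≤ wordDist u (w * FreeGroup.of a) + 1)
  rw [edge_apply, min_eq_left] <;> simp [h']

lemma edge_one_apply (w : FreeGroup α) (a : α) (u : FreeGroup α) :
    edge w a 1 u = wordDist u (w * FreeGroup.of a) := by
  have h := isTreeDist_wordDist.adj u (wordDist_mul_of w a)
  have h' : (wordDist u (w * FreeGroup.of a) : ℝ) ≤ wordDist u w + 1 := by
    exact_mod_cast (by omega : wordDist u (w * FreeGroup.of a) ≤ wordDist u w + 1)
  rw [edge_apply, min_eq_right] <;> simp [h']

lemma edge_zero_eq (w : FreeGroup α) (a b : α) : edge w a 0 = edge w b 0 :=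
  Tree.ext fun u => by rw [edge_zero_apply, edge_zero_apply]

lemma edge_one_eq (w : FreeGroup α) (a b : α) : edge w a 1 = edge (w * FreeGroup.of a) b 0 :=
  Tree.ext fun u => by rw [edge_zero_apply, edge_one_apply]

lemma edge_apply_start (w : FreeGroup α) (a : α) (t : I) : edge w a t w = t := by
  have := t.2.2
  rw [edge_apply, wordDist_self, wordDist_mul_of, min_eq_left] <;> push_cast <;> linarith

lemma edge_apply_end (w : FreeGroup α) (a : α) (t : I) :
    edge w a t (w * FreeGroup.of a) = 1 - t := by
  have := t.2.1
  rw [edge_apply, wordDist_self, wordDist_comm, wordDist_mul_of, min_eq_right] <;> push_cast <;>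
    linarith

lemma eq_or_eq_of_edge_apply_lt_one {w : FreeGroup α} {a : α} {t : I} {u : FreeGroup α}
    (h : edge w a t u < 1) : u = w ∨ u = w * FreeGroup.of a := by
  by_contra! h'
  have h2 : (1 : ℝ) ≤ wordDist u w := by exact_mod_cast wordDist_pos h'.1
  have h3 : (1 : ℝ) ≤ wordDist u (w * FreeGroup.of a) := by exact_mod_cast wordDist_pos h'.2
  rw [edge_apply] at h
  have h4 := t.2.1
  have h5 := t.2.2
  rcases min_lt_iff.mp h with h6 | h6 <;> linarith

omit [DecidableEq α] in
lemma of_mul_of_ne_one (a b : α) : FreeGroup.of a * FreeGroup.of b ≠ 1 := by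
  intro h
  -- The exponent sum of the product is `2`.
  have := congrArg (fun w => FreeGroup.lift (fun _ : α => Multiplicative.ofAdd (1 : ℤ)) w) h
  simp [← ofAdd_add] at this

/-- The vertices at distance less than `1` from an interior point are the two ends of its edge. The
ends of edges are recognised by integral values. -/
lemma edge_eq_edge {w w' : FreeGroup α} {a b : α} {s t : I} (h : edge w a s = edge w' b t) :
    (w = w' ∧ a = b ∧ s = t) ∨ ((s = 0 ∨ s = 1) ∧ (t = 0 ∨ t = 1)) := by
  have bdry : ∀ {w w' : FreeGroup α} {a b : α} {s t : I}, edge w a s = edge w' b t →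
      (s = 0 ∨ s = 1) → (t = 0 ∨ t = 1) := by
    intro w w' a b s t h hs
    have h1 := edge_apply_start w' b t
    rw [← h] at h1
    obtain ⟨n, hn⟩ : ∃ n : ℕ, (t : ℝ) = n := by
      rcases hs with rfl | rfl
      · exact ⟨_, h1.symm.trans (edge_zero_apply _ _ _)⟩
      · exact ⟨_, h1.symm.trans (edge_one_apply _ _ _)⟩
    have h2 : n ≤ 1 := by
      have := t.2.2
      rw [hn] at this
      exact_mod_cast this
    interval_cases n
    · left; exact Subtype.ext (by simpa using hn)
    · right; exact Subtype.ext (by simpa using hn)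
  by_cases hs : s = 0 ∨ s = 1
  · exact Or.inr ⟨hs, bdry h hs⟩
  by_cases ht : t = 0 ∨ t = 1
  · exact Or.inr ⟨bdry h.symm ht, ht⟩
  left
  push Not at hs ht
  have lt1 : ∀ {t : I}, t ≠ 1 → (t : ℝ) < 1 := fun h => unitInterval.lt_one_iff_ne_one.mpr h
  have pos : ∀ {t : I}, t ≠ 0 → (0 : ℝ) < t := fun h => unitInterval.pos_iff_ne_zero.mpr h
  have h1 : w' = w ∨ w' = w * FreeGroup.of a := eq_or_eq_of_edge_apply_lt_one (t := s) (by
    rw [h, edge_apply_start]; exact lt1 ht.2)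
  have h2 : w' * FreeGroup.of b = w ∨ w' * FreeGroup.of b = w * FreeGroup.of a :=
    eq_or_eq_of_edge_apply_lt_one (t := s) (by
      rw [h, edge_apply_end]; linarith [pos ht.1])
  rcases h1 with rfl | rfl
  · rcases h2 with h2 | h2
    · exact absurd (mul_eq_left.mp h2) (FreeGroup.of_ne_one b)
    · refine ⟨rfl, (FreeGroup.of_injective (mul_left_cancel h2)).symm, ?_⟩
      have := edge_apply_start w' a s
      rw [h, edge_apply_start] at this
      exact Subtype.ext this.symm
  -- The second edge would start at the end of the first, so it would leave it or be its reverse;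
  -- the reverse needs `of a * of b = 1`.
  · exfalso
    rcases h2 with h2 | h2
    · rw [mul_assoc, mul_eq_left] at h2
      exact of_mul_of_ne_one a b h2
    · exact FreeGroup.of_ne_one b (mul_eq_left.mp h2)

/-- An edge that meets the unit ball around `x` starts at a word of length at most `x 1 + 2`, and
there are finitely many of these. Consequently continuity on the tree can be tested on edges. -/
lemma locallyFinite_edges [Finite α] :
    LocallyFinite fun i : FreeGroup α × α => Set.range (edge i.1 i.2) := by
  intro x
  refine ⟨Metric.ball x 1, Metric.ball_mem_nhds x one_pos, ?_⟩
  obtain ⟨N, hN⟩ := exists_nat_ge (x 1 + 2)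
  have hfin : Set.Finite {w : FreeGroup α | w.norm ≤ N} :=
    Set.Finite.of_finite_image
      ((List.finite_length_le (α × Bool) N).subset (Set.image_subset_iff.mpr fun w hw => hw))
      FreeGroup.toWord_injective.injOn
  refine (hfin.prod Set.finite_univ).subset ?_
  rintro ⟨w, a⟩ ⟨_, ⟨t, rfl⟩, ht⟩
  refine ⟨?_, trivial⟩
  have h1 := Tree.abs_sub_le_dist (edge w a t) x 1
  have h2 := abs_le.mp (h1.trans (Metric.mem_ball.mp ht).le)
  have h3 : (w.norm : ℝ) - 1 ≤ edge w a t 1 := by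
    have h := isTreeDist_wordDist.adj 1 (wordDist_mul_of w a)
    have h' : (wordDist 1 w : ℝ) ≤ wordDist 1 (w * FreeGroup.of a) + 1 := by
      exact_mod_cast (by omega : wordDist 1 w ≤ wordDist 1 (w * FreeGroup.of a) + 1)
    have h4 : wordDist 1 w = w.norm := by simp [wordDist]
    rw [h4] at h'
    rw [edge_apply, h4]
    have := t.2.1
    have := t.2.2
    exact le_min (by linarith) (by linarith)
  have h5 : (w.norm : ℝ) ≤ N := by linarith
  exact_mod_cast h5

lemma continuous_of_edges [Finite α] {Z : Type*} [TopologicalSpace Z] {f : FreeTree α → Z}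
    (hf : ∀ w a, Continuous fun t => f (edge w a t)) : Continuous f := by
  refine continuous_iff_isClosed.mpr fun C hC => ?_
  have : f ⁻¹' C = ⋃ i : FreeGroup α × α, edge i.1 i.2 '' ((fun t => f (edge i.1 i.2 t)) ⁻¹' C) := by
    ext x
    simp only [Set.mem_preimage, Set.mem_iUnion, Set.mem_image]
    constructor
    · intro hx
      obtain ⟨w, a, t, rfl⟩ := exists_eq_edge x
      exact ⟨(w, a), t, hx, rfl⟩
    · rintro ⟨i, t, ht, rfl⟩
      exact ht
  rw [this]
  refine (locallyFinite_edges.subset fun i => Set.image_subset_range _ _).isClosed_iUnion fun i => ?_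
  exact ((hC.preimage (hf _ _)).isCompact.image (continuous_edge _ _)).isClosed

end FreeTree

open FreeTree

/-- The wedge of circles indexed by `α`. -/
def Rose (α : Type u) [DecidableEq α] : Type u := MulAction.orbitRel.Quotient (FreeGroup α) (FreeTree α)

namespace Rose

instance : TopologicalSpace (Rose α) :=
  inferInstanceAs (TopologicalSpace (Quotient (MulAction.orbitRel (FreeGroup α) (FreeTree α))))

/-- The universal covering of a rose. -/
def proj (x : FreeTree α) : Rose α := Quotient.mk (MulAction.orbitRel (FreeGroup α) (FreeTree α)) x

lemma isCombedCover : IsCombedCover (F := FreeGroup α) (proj (α := α)) Tree.comb where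
  toIsQuotientMap := isQuotientMap_quotient_mk'
  continuous_const_smul := continuous_const_smul
  apply_eq_iff_mem_orbit := Quotient.eq''
  disjoint x := by
    -- Points of this ball are less than `1` apart, whereas a nontrivial element moves every point
    -- by at least `1`.
    refine ⟨Metric.ball x (1 / 2), Metric.ball_mem_nhds x (by norm_num), fun g hg => ?_⟩
    by_contra hg1
    obtain ⟨_, ⟨y, hy, rfl⟩, hy'⟩ := hg
    have h1 := one_le_dist_smul hg1 y
    have h2 := dist_triangle_right y (g • y) x
    have h3 := Metric.mem_ball.mp hy
    have h4 := Metric.mem_ball.mp hy'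
    simp only at h4
    linarith
  continuous_comb := Tree.continuous_comb
  comb_zero := Tree.comb_zero
  comb_one := Tree.comb_one
  comb_self := Tree.comb_self
  comb_smul := FreeTree.comb_smul

/-- The loop around a circle of the rose. -/
noncomputable def petal (a : α) (t : I) : Rose α := proj (edge 1 a t)

lemma continuous_petal (a : α) : Continuous (petal a) :=
  isCombedCover.continuous.comp (continuous_edge 1 a)

lemma proj_smul (g : FreeGroup α) (x : FreeTree α) : proj (g • x) = proj x :=
  isCombedCover.toIsQuotientCoveringMap.map_smul g

lemma proj_edge (w : FreeGroup α) (a : α) (t : I) : proj (edge w a t) = petal a t := by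
  rw [petal, ← proj_smul w (edge 1 a t), smul_edge, mul_one]

lemma petal_zero_eq (a b : α) : petal a 0 = petal b 0 := congrArg proj (edge_zero_eq 1 a b)

lemma petal_one_eq (a b : α) : petal a 1 = petal b 0 := by
  rw [petal, edge_one_eq 1 a b, proj_edge]

/-- A family of loops with the same base point defines a map on the rose. -/
lemma exists_lift [Finite α] {Z : Type*} [TopologicalSpace Z] (b : Z) (l : α → C(I, Z))
    (h0 : ∀ a, l a 0 = b) (h1 : ∀ a, l a 1 = b) :
    ∃ f : C(Rose α, Z), ∀ a t, f (petal a t) = l a t := by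
  -- The coordinates are arbitrary; `key` shows that the ambiguity, which occurs only at vertices,
  -- does not affect the value.
  choose w a t hx using exists_eq_edge (α := α)
  have key : ∀ w' a' t', l (a (edge w' a' t')) (t (edge w' a' t')) = l a' t' := by
    intro w' a' t'
    rcases edge_eq_edge (hx (edge w' a' t')) with ⟨-, h2, h3⟩ | ⟨h2, h3⟩
    · rw [← h2, ← h3]
    · have : ∀ (a : α) (t : I), t = 0 ∨ t = 1 → l a t = b := by
        rintro a t (rfl | rfl)
        exacts [h0 a, h1 a]
      rw [this _ _ h2, this _ _ h3]
  let f : FreeTree α → Z := fun x => l (a x) (t x)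
  have hf : Continuous f := continuous_of_edges fun w a => by
    simp only [f, key]; exact (l a).continuous
  have hinv : ∀ x y : FreeTree α, (MulAction.orbitRel (FreeGroup α) (FreeTree α)) x y → f x = f y := by
    rintro x y ⟨g, rfl⟩
    obtain ⟨w', a', t', rfl⟩ := exists_eq_edge y
    simp only [smul_edge, f, key]
  exact ⟨⟨Quotient.lift f hinv, hf.quotient_lift hinv⟩, fun a' t' => key 1 a' t'⟩

end Rose

end FreeTree

instance : PathConnectedSpace I :=
  isPathConnected_iff_pathConnectedSpace.mp ((convex_Icc 0 1).isPathConnected ⟨0, by simp⟩)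

/-! ### Finite graphs from one-dimensional CW complexes. -/

/-- A finite graph: a space glued from finitely many vertices and edges. -/
structure IsFiniteGraph {G V E : Type*} [TopologicalSpace G] (v : V → G) (e : E → C(I, G)) :
    Prop where
  t2 : T2Space G
  finite_vertex : Finite V
  finite_edge : Finite E
  cover : ∀ x, (∃ i, x = v i) ∨ ∃ j t, x = e j t
  edge_vertex : ∀ {j t i}, e j t = v i → t = 0 ∨ t = 1
  edge_edge : ∀ {j j' t t'}, e j t = e j' t' → (t = 0 ∨ t = 1) ∨ (j = j' ∧ t = t')

open Topology in
lemma exists_isFiniteGraph {G : Type u} [TopologicalSpace G] [T2Space G]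
    [CWComplex (Set.univ : Set G)] (hfin : CWComplex.Finite (Set.univ : Set G))
    (hdim : ∀ n, 2 ≤ n → IsEmpty (RelCWComplex.cell (Set.univ : Set G) n)) :
    ∃ (V E : Type u) (v : V → G) (e : E → C(I, G)), IsFiniteGraph v e := by
  have hcells := RelCWComplex.finite_cells_of_finite (C := (Set.univ : Set G)) (finite := hfin)
  have hfin' (n : ℕ) : Finite (RelCWComplex.cell (Set.univ : Set G) n) :=
    Finite.of_injective (fun i => (⟨n, i⟩ : Σ n, RelCWComplex.cell (Set.univ : Set G) n))
      fun i j h => by simpa using h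
  -- Affine identification of `I` with the closed unit ball of dimension one, the domain of a
  -- `1`-cell.
  let c : I → Fin 1 → ℝ := fun t _ => 2 * t - 1
  have hc : Continuous c := by fun_prop
  have hcmem : ∀ t, c t ∈ Metric.closedBall (0 : Fin 1 → ℝ) 1 := by
    intro t
    rw [mem_closedBall_zero_iff, pi_norm_le_iff_of_nonneg zero_le_one]
    intro _
    rw [Real.norm_eq_abs, abs_le]
    have := t.2.1
    have := t.2.2
    constructor <;> simp only [c] <;> linarith
  have hcball : ∀ t : I, t ≠ 0 → t ≠ 1 → c t ∈ Metric.ball (0 : Fin 1 → ℝ) 1 := by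
    intro t h0 h1
    rw [mem_ball_zero_iff, pi_norm_lt_iff zero_lt_one]
    intro _
    rw [Real.norm_eq_abs, abs_lt]
    have := unitInterval.pos_iff_ne_zero.mpr h0
    have := unitInterval.lt_one_iff_ne_one.mpr h1
    have h2 : (0 : ℝ) < t := by assumption
    have h3 : (t : ℝ) < 1 := by assumption
    constructor <;> simp only [c] <;> linarith
  have hcinj : Function.Injective c := fun s t h => Subtype.ext (by
    have := congrFun h 0
    simp only [c] at this
    linarith)
  have hcsurj : ∀ y ∈ Metric.closedBall (0 : Fin 1 → ℝ) 1, ∃ t, c t = y := by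
    intro y hy
    rw [mem_closedBall_zero_iff, pi_norm_le_iff_of_nonneg zero_le_one] at hy
    have := abs_le.mp (hy 0)
    refine ⟨⟨(y 0 + 1) / 2, by linarith, by linarith⟩, ?_⟩
    funext i
    obtain rfl : i = 0 := Subsingleton.elim _ _
    simp only [c]
    ring
  let v : RelCWComplex.cell (Set.univ : Set G) 0 → G := fun i => RelCWComplex.map 0 i ![]
  let e : RelCWComplex.cell (Set.univ : Set G) 1 → C(I, G) := fun j =>
    ⟨fun t => RelCWComplex.map 1 j (c t),
      (RelCWComplex.continuousOn 1 j).comp_continuous hc hcmem⟩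
  have hopen : ∀ j (t : I), t ≠ 0 → t ≠ 1 → e j t ∈ RelCWComplex.openCell 1 j :=
    fun j t h0 h1 => ⟨c t, hcball t h0 h1, rfl⟩
  refine ⟨_, _, v, e, ⟨inferInstance, hfin' 0, hfin' 1, ?_, ?_, ?_⟩⟩
  · intro x
    have hx : x ∈ ⋃ (n : ℕ) (j : RelCWComplex.cell (Set.univ : Set G) n),
        RelCWComplex.closedCell n j := by rw [CWComplex.union]; trivial
    simp only [Set.mem_iUnion] at hx
    obtain ⟨n, j, hx⟩ := hx
    rcases n with _ | _ | n
    · left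
      rw [RelCWComplex.closedCell_zero_eq_singleton] at hx
      exact ⟨j, hx⟩
    · right
      obtain ⟨y, hy, rfl⟩ := hx
      obtain ⟨t, rfl⟩ := hcsurj y hy
      exact ⟨j, t, rfl⟩
    · exact ((hdim (n + 2) (by omega)).false j).elim
  · intro j t i h
    by_contra! hne
    have h1 := hopen j t hne.1 hne.2
    have h2 : v i ∈ RelCWComplex.openCell 0 i := by
      rw [RelCWComplex.openCell_zero_eq_singleton]; rfl
    rw [h] at h1
    have := RelCWComplex.eq_of_not_disjoint_openCell (Set.not_disjoint_iff.mpr ⟨_, h1, h2⟩)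
    simpa using congrArg Sigma.fst this
  · intro j j' t t' h
    by_cases ht : t = 0 ∨ t = 1
    · exact Or.inl ht
    right
    push Not at ht
    have h1 := hopen j t ht.1 ht.2
    by_cases ht' : t' = 0 ∨ t' = 1
    · exfalso
      -- The ends of an edge lie in `0`-cells, which are disjoint from the open `1`-cells.
      have h2 : e j' t' ∈ RelCWComplex.cellFrontier 1 j' := by
        rw [RelCWComplex.cellFrontier_one_eq]
        refine ⟨c t', ?_, rfl⟩
        rcases ht' with rfl | rfl
        · left; funext i; simp [c]
        · right; funext i; simp [c]; norm_num
      obtain ⟨x, y, hxy⟩ := CWComplex.exists_cellFrontier_one_eq j'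
      rw [hxy] at h2
      rw [h] at h1
      have key : ∀ z : RelCWComplex.cell (Set.univ : Set G) 0,
          e j' t' ∈ RelCWComplex.closedCell 0 z → False := by
        intro z hz
        rw [RelCWComplex.closedCell_zero_eq_singleton,
          ← RelCWComplex.openCell_zero_eq_singleton] at hz
        have := RelCWComplex.eq_of_not_disjoint_openCell (Set.not_disjoint_iff.mpr ⟨_, h1, hz⟩)
        simpa using congrArg Sigma.fst this
      rcases h2 with h2 | h2
      exacts [key _ h2, key _ h2]
    · push Not at ht'
      have h2 := hopen j' t' ht'.1 ht'.2
      rw [h] at h1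
      have := RelCWComplex.eq_of_not_disjoint_openCell (Set.not_disjoint_iff.mpr ⟨_, h1, h2⟩)
      obtain rfl : j = j' := by simpa using this
      refine ⟨rfl, hcinj ((RelCWComplex.map 1 j).injOn ?_ ?_ h)⟩
      · rw [RelCWComplex.source_eq]; exact hcball t ht.1 ht.2
      · rw [RelCWComplex.source_eq]; exact hcball t' ht'.1 ht'.2

namespace IsFiniteGraph

variable {G V E : Type*} [TopologicalSpace G] {v : V → G} {e : E → C(I, G)}

/-- The preimage of a closed set is a finite union of compact images, hence closed in the Hausdorff
space `G × I`. -/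
lemma continuous_prod (hG : IsFiniteGraph v e) {Z : Type*} [TopologicalSpace Z] {f : G × I → Z}
    (hv : ∀ i, Continuous fun u => f (v i, u))
    (he : ∀ j, Continuous fun p : I × I => f (e j p.1, p.2)) : Continuous f := by
  have := hG.t2
  have := hG.finite_vertex
  have := hG.finite_edge
  refine continuous_iff_isClosed.mpr fun C hC => ?_
  have : f ⁻¹' C = (⋃ i, (fun u => (v i, u)) '' ((fun u => f (v i, u)) ⁻¹' C)) ∪
      ⋃ j, (fun p : I × I => (e j p.1, p.2)) '' ((fun p : I × I => f (e j p.1, p.2)) ⁻¹' C) := by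
    ext ⟨x, u⟩
    simp only [Set.mem_preimage, Set.mem_union, Set.mem_iUnion, Set.mem_image]
    constructor
    · intro hx
      rcases hG.cover x with ⟨i, rfl⟩ | ⟨j, t, rfl⟩
      · exact Or.inl ⟨i, u, hx, rfl⟩
      · exact Or.inr ⟨j, (t, u), hx, rfl⟩
    · rintro (⟨i, u', hu, h⟩ | ⟨j, p, hp, h⟩)
      · rw [← h]; exact hu
      · rw [← h]; exact hp
  rw [this]
  refine (isClosed_iUnion_of_finite fun i => ?_).union (isClosed_iUnion_of_finite fun j => ?_)
  · exact ((hC.preimage (hv i)).isCompact.image (by fun_prop)).isClosed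
  · exact ((hC.preimage (he j)).isCompact.image (by fun_prop)).isClosed

lemma continuous_of_edges (hG : IsFiniteGraph v e) {Z : Type*} [TopologicalSpace Z] {f : G → Z}
    (he : ∀ j, Continuous fun t => f (e j t)) : Continuous f := by
  have : Continuous fun p : G × I => f p.1 :=
    hG.continuous_prod (fun i => continuous_const (y := f (v i))) fun j =>
      (he j).comp continuous_fst
  exact this.comp (Continuous.prodMk_left 0)

open Classical in
/-- The function that is `f j t` at the interior point `e j t` and `g` at the vertices. -/
noncomputable def glue (e : E → C(I, G)) {Z : Type*} (f : E → I → Z) (g : G → Z) (x : G) : Z :=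
  if h : ∃ (j : E) (t : I), ¬ (t = 0 ∨ t = 1) ∧ x = e j t then f h.choose h.choose_spec.choose
  else g x

lemma glue_edge (hG : IsFiniteGraph v e) {Z : Type*} {f : E → I → Z} {g : G → Z}
    (h0 : ∀ j, f j 0 = g (e j 0)) (h1 : ∀ j, f j 1 = g (e j 1)) (j : E) (t : I) :
    glue e f g (e j t) = f j t := by
  rw [glue]
  split_ifs with h
  · obtain ⟨ht, hx⟩ := h.choose_spec.choose_spec
    rcases hG.edge_edge hx.symm with h' | ⟨h2, h3⟩
    · exact absurd h' ht
    · rw [h3]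
      congr
  · by_cases ht : t = 0 ∨ t = 1
    · rcases ht with rfl | rfl
      exacts [(h0 j).symm, (h1 j).symm]
    · exact absurd ⟨j, t, ht, rfl⟩ h

lemma glue_vertex (hG : IsFiniteGraph v e) {Z : Type*} {f : E → I → Z} {g : G → Z} (i : V) :
    glue e f g (v i) = g (v i) := by
  rw [glue, dif_neg]
  rintro ⟨j, t, ht, hx⟩
  exact ht (hG.edge_vertex hx.symm)

end IsFiniteGraph

/-! ### Domination of a graph by a finite set times a rose. -/

section Tail

variable {G : Type*} [TopologicalSpace G]

/-- The conjugate `p · c · q⁻¹` of the path `c`, on the interval `[0, 3]`. -/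
noncomputable def conjPath (c : C(I, G)) {a b : G} (p : Path a (c 0)) (q : Path b (c 1)) (x : ℝ) : G :=
  if x ≤ 1 then p.extend x else if x ≤ 2 then c (Set.projIcc 0 1 zero_le_one (x - 1))
    else q.extend (3 - x)

lemma continuous_conjPath (c : C(I, G)) {a b : G} (p : Path a (c 0)) (q : Path b (c 1)) :
    Continuous (conjPath c p q) := by
  refine Continuous.if_le p.continuous_extend
    (Continuous.if_le ?_ ?_ continuous_id continuous_const ?_) continuous_id continuous_const ?_
  · exact c.continuous.comp (continuous_projIcc.comp (by fun_prop))
  · exact q.continuous_extend.comp (by fun_prop)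
  · rintro x rfl
    norm_num
  · rintro x rfl
    rw [if_pos (by norm_num), sub_self, Path.extend_one]
    simp

lemma conjPath_of_le {c : C(I, G)} {a b : G} {p : Path a (c 0)} {q : Path b (c 1)} {x : ℝ}
    (hx : x ≤ 1) : conjPath c p q x = p.extend x := if_pos hx

lemma conjPath_one_add {c : C(I, G)} {a b : G} {p : Path a (c 0)} {q : Path b (c 1)} (t : I) :
    conjPath c p q (1 + t) = c t := by
  by_cases ht : t = 0
  · subst ht
    rw [conjPath_of_le (by simp)]
    simp
  · have h0 : (0 : ℝ) < t := unitInterval.pos_iff_ne_zero.mpr ht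
    have h1 := t.2.2
    rw [conjPath, if_neg (by linarith), if_pos (by linarith)]
    simp

lemma conjPath_two_add {c : C(I, G)} {a b : G} {p : Path a (c 0)} {q : Path b (c 1)} (t : I) :
    conjPath c p q (2 + t) = q (σ t) := by
  by_cases ht : t = 0
  · subst ht
    have := conjPath_one_add (p := p) (q := q) 1
    rw [show (1 : ℝ) + (1 : I) = 2 + (0 : I) by norm_num] at this
    rw [this]
    simp
  · have h0 : (0 : ℝ) < t := unitInterval.pos_iff_ne_zero.mpr ht
    rw [conjPath, if_neg (by linarith), if_neg (by linarith),
      show (3 : ℝ) - (2 + t) = (σ t : I) by simp; ring, Path.extend_apply]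

end Tail

open IsFiniteGraph in
/-- A finite graph is dominated by the product of a finite set and a rose. -/
lemma IsFiniteGraph.exists_domination {G V E : Type u} [TopologicalSpace G] {v : V → G}
    {e : E → C(I, G)} (hG : IsFiniteGraph v e) [DecidableEq E] :
    ∃ (C : Set G) (_ : Finite C) (φ : C(G, Rose (Option E))) (l : C(G, C))
      (ψ : C(C × Rose (Option E), G)),
      (ContinuousMap.id G).Homotopic (ψ.comp (l.prodMk φ)) := by
  classical
  have := hG.t2
  have := hG.finite_vertex
  have := hG.finite_edge
  have hfin : Finite (ZerothHomotopy G) := by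
    refine Finite.of_surjective (α := V ⊕ E)
      (Sum.elim (fun i => ZerothHomotopy.mk (v i)) fun j => ZerothHomotopy.mk (e j 0)) fun x => ?_
    obtain ⟨x, rfl⟩ := Quotient.exists_rep x
    rcases hG.cover x with ⟨i, rfl⟩ | ⟨j, t, rfl⟩
    · exact ⟨Sum.inl i, rfl⟩
    · exact ⟨Sum.inr j, Quotient.sound ((PathConnectedSpace.joined 0 t).map (e j).continuous)⟩
  -- A base point for each path component, and below a path `τ` from it to every point; `τ` need not
  -- be continuous in the point.
  let rep : G → G := fun x => Quotient.out (ZerothHomotopy.mk x)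
  have hrep : ∀ x, Joined (rep x) x := fun x => Quotient.mk_out (s := pathSetoid G) x
  have hrepeq : ∀ {x y}, Joined x y → rep x = rep y := fun h =>
    congrArg Quotient.out (Quotient.sound h)
  have hrepe : ∀ j s t, rep (e j s) = rep (e j t) := fun j s t =>
    hrepeq ((PathConnectedSpace.joined s t).map (e j).continuous)
  let τ : ∀ x, Path (rep x) x := fun x => (hrep x).somePath
  have hC : Finite (Set.range rep) := by
    have : Set.range rep ⊆ Set.range (fun x : ZerothHomotopy G => Quotient.out x) := by
      rintro _ ⟨x, rfl⟩
      exact ⟨_, rfl⟩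
    exact (Set.finite_range _).subset this
  -- Both ends of an edge have the same base point, so `P j` is a loop there with `e j` as its
  -- middle third.
  let P : E → ℝ → G := fun j => conjPath (e j) (τ (e j 0)) (τ (e j 1))
  have hP : ∀ j, Continuous (P j) := fun j => continuous_conjPath _ _ _
  have hP0 : ∀ j, P j 0 = rep (e j 0) := fun j => by
    simp only [P]
    rw [conjPath_of_le (by norm_num), Path.extend_zero]
  have hP3 : ∀ j, P j 3 = rep (e j 0) := fun j => by
    have := conjPath_two_add (p := τ (e j 0)) (q := τ (e j 1)) 1
    rw [show (2 : ℝ) + (1 : I) = 3 by norm_num] at this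
    simp only [P]
    rw [this]
    simp [hrepe j 1 0]
  -- the map to the rose
  let φ : G → Rose (Option E) := glue e (fun j t => Rose.petal (some j) t)
    fun _ => Rose.petal none 0
  have hφe : ∀ j t, φ (e j t) = Rose.petal (some j) t := hG.glue_edge
    (fun j => Rose.petal_zero_eq _ _) fun j => Rose.petal_one_eq _ _
  have hφv : ∀ i, φ (v i) = Rose.petal none 0 := fun i => hG.glue_vertex i
  have hφ : Continuous φ := hG.continuous_of_edges fun j => by
    simp only [hφe]; exact Rose.continuous_petal _
  let l : G → Set.range rep := fun x => ⟨rep x, x, rfl⟩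
  have hl : Continuous l := hG.continuous_of_edges fun j => by
    have : ∀ t, l (e j t) = l (e j 0) := fun t => Subtype.ext (hrepe j t 0)
    simp only [this]
    exact continuous_const
  -- the map from the rose
  have hψ : ∀ c : Set.range rep, ∃ f : C(Rose (Option E), G), ∀ a t, f (Rose.petal a t) =
      (Option.elim a (ContinuousMap.const I c.1) fun j => if rep (e j 0) = c then
        ⟨fun t : I => P j (3 * t), by fun_prop⟩ else ContinuousMap.const I c.1 : C(I, G)) t := by
    intro c
    refine Rose.exists_lift c.1 _ ?_ ?_
    · rintro (_ | j)
      · rfl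
      · simp only [Option.elim]
        split_ifs with h
        · simp [hP0, h]
        · rfl
    · rintro (_ | j)
      · rfl
      · simp only [Option.elim]
        split_ifs with h
        · simp [hP3, h]
        · rfl
  choose ψ hψ using hψ
  -- At time `u` an edge is stretched over the interval `[1 - u, 2 + u]` of its loop, while vertices
  -- retreat along `τ` to the base point.
  let H : G × I → G := fun p => glue e (fun j t => P j ((1 - p.2) + t * (1 + 2 * p.2)))
    (fun x => τ x (σ p.2)) p.1
  have hHe : ∀ j t u, H (e j t, u) = P j ((1 - u) + t * (1 + 2 * u)) := fun j t u => by
    refine hG.glue_edge (fun j => ?_) (fun j => ?_) j t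
    · simp only [P]
      have := u.2.1
      rw [conjPath_of_le (by simp [this])]
      rw [show (1 - (u : ℝ) + (0 : I) * (1 + 2 * u)) = (σ u : I) by simp, Path.extend_apply]
    · simp only [P]
      rw [← conjPath_two_add (p := τ (e j 0))]
      congr 1
      simp; ring
  have hHv : ∀ i u, H (v i, u) = τ (v i) (σ u) := fun i u => hG.glue_vertex i
  have hH : Continuous H := by
    refine hG.continuous_prod (fun i => ?_) fun j => ?_
    · simp only [hHv]; fun_prop
    · simp only [hHe]; fun_prop
  refine ⟨Set.range rep, hC, ⟨φ, hφ⟩, ⟨l, hl⟩, ⟨fun p => ψ p.1 p.2, ?_⟩, ⟨⟨⟨fun p => H (p.2, p.1), by fun_prop⟩, ?_, ?_⟩⟩⟩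
  · refine continuous_prod_of_discrete_left.mpr fun c => (ψ c).continuous
  · intro x
    show H (x, 0) = x
    rcases hG.cover x with ⟨i, rfl⟩ | ⟨j, t, rfl⟩
    · rw [hHv]; simp
    · rw [hHe]
      rw [← conjPath_one_add (p := τ (e j 0)) (q := τ (e j 1)) t]
      simp [P]
  · intro x
    show H (x, 1) = ψ (l x) (φ x)
    rcases hG.cover x with ⟨i, rfl⟩ | ⟨j, t, rfl⟩
    · rw [hHv, hφv, hψ]; simp [l]
    · rw [hHe, hφe, hψ]
      simp only [Option.elim, l]
      rw [if_pos (hrepe j 0 t)]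
      show _ = P j (3 * t)
      congr 1
      simp; ring

/-- An h-graph is dominated by the product of a finite set and a rose. -/
lemma IsHGraph.exists_domination {X : Type u} [TopologicalSpace X] (hX : IsHGraph X) :
    ∃ (α : Type u) (_ : DecidableEq α) (_ : Finite α) (_ : Nonempty α) (C : Type u) (_ : TopologicalSpace C)
      (_ : DiscreteTopology C) (_ : Finite C) (φ : C(X, Rose α)) (l : C(X, C))
      (ψ : C(C × Rose α, X)), (ContinuousMap.id X).Homotopic (ψ.comp (l.prodMk φ)) := by
  classical
  obtain ⟨-, G, _, _, _, hfin, hdim, ⟨eq⟩⟩ := hX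
  obtain ⟨V, E, v, e, hG⟩ := exists_isFiniteGraph hfin hdim
  have := hG.finite_edge
  obtain ⟨C, hC, φ, l, ψ, h⟩ := hG.exists_domination
  have := hG.t2
  refine ⟨Option E, inferInstance, inferInstance, inferInstance, C, inferInstance, inferInstance, hC,
    φ.comp eq.toFun, l.comp eq.toFun, eq.invFun.comp ψ, ?_⟩
  refine eq.left_inv.symm.trans ?_
  have := (ContinuousMap.Homotopic.refl eq.invFun).comp (h.comp (.refl eq.toFun))
  exact this

/-- An h-graph has finitely many path components. -/
lemma IsHGraph.exists_finite_joined {X : Type u} [TopologicalSpace X] (hX : IsHGraph X) :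
    ∃ Q : Set X, Q.Finite ∧ ∀ x, ∃ y ∈ Q, Joined y x := by
  obtain ⟨-, G, _, _, _, hfin, hdim, ⟨eq⟩⟩ := hX
  obtain ⟨V, E, v, e, hG⟩ := exists_isFiniteGraph hfin hdim
  have := hG.finite_vertex
  have := hG.finite_edge
  refine ⟨Set.range (fun i => eq.invFun (v i)) ∪ Set.range fun j => eq.invFun (e j 0),
    (Set.finite_range _).union (Set.finite_range _), fun x => ?_⟩
  obtain ⟨F⟩ := eq.left_inv
  have hx : Joined (eq.invFun (eq.toFun x)) x := ⟨F.evalAt x⟩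
  rcases hG.cover (eq.toFun x) with ⟨i, hi⟩ | ⟨j, t, hj⟩
  · exact ⟨_, Or.inl ⟨i, rfl⟩, by rwa [hi] at hx⟩
  · refine ⟨_, Or.inr ⟨j, rfl⟩, ?_⟩
    rw [hj] at hx
    exact ((PathConnectedSpace.joined 0 t).map (eq.invFun.continuous.comp (e j).continuous)).trans hx

/-! ### k-spaces: products, evaluation and closed cofibrations. -/

section CompactlyGenerated

variable {X : Type u} [TopologicalSpace X] [CompactlyGeneratedSpace X]

/-- Currying over the compact `K` turns the claim into continuity of a map on `X`, which is tested
on compact `L`; then `L × K` is itself a test space. -/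
lemma compactlyGeneratedSpace_prod (K : Type u) [TopologicalSpace K] [CompactSpace K] [T2Space K] :
    CompactlyGeneratedSpace (X × K) := by
  refine compactlyGeneratedSpace_of_continuous_maps fun {Y} _ f hf => ?_
  have h1 : ∀ x, Continuous fun k => f (x, k) := fun x => hf K _ (Continuous.prodMk_right x)
  have h2 : Continuous fun x => (⟨fun k => f (x, k), h1 x⟩ : C(K, Y)) := by
    refine continuous_from_compactlyGeneratedSpace _ fun L _ _ _ g hg => ?_
    refine ContinuousMap.continuous_of_continuous_uncurry _ ?_
    exact hf (L × K) (fun p => (g p.1, p.2)) (by fun_prop)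
  exact ContinuousMap.continuous_uncurry_of_continuous ⟨_, h2⟩

instance compactlyGeneratedSpace_prod_unitInterval : CompactlyGeneratedSpace (X × I) := by
  have := compactlyGeneratedSpace_prod (X := X) (ULift.{u} I)
  let e : X × ULift.{u} I ≃ₜ X × I := (Homeomorph.refl X).prodCongr Homeomorph.ulift
  exact compactlyGeneratedSpace_of_coinduced e.continuous e.isQuotientMap.eq_coinduced

/-- Evaluation need not be jointly continuous when `X` is not locally compact. For compact `K` one
curries the other way and tests `X` on compact spaces. -/
lemma continuous_eval_of_compactlyGenerated {K : Type u} [TopologicalSpace K] [CompactSpace K]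
    [T2Space K] {Y : Type*} [TopologicalSpace Y] {k : K → C(X, Y)} (hk : Continuous k) :
    Continuous fun p : K × X => k p.1 p.2 := by
  have h1 : Continuous fun x => (⟨fun a => k a x, by fun_prop⟩ : C(K, Y)) := by
    refine continuous_from_compactlyGeneratedSpace _ fun L _ _ _ g hg => ?_
    refine ContinuousMap.continuous_of_continuous_uncurry _ ?_
    have h2 : Continuous fun a => (k a).comp ⟨g, hg⟩ := (ContinuousMap.continuous_precomp _).comp hk
    have h3 := ContinuousMap.continuous_uncurry_of_continuous ⟨_, h2⟩
    exact h3.comp continuous_swap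
  exact (ContinuousMap.continuous_uncurry_of_continuous ⟨_, h1⟩).comp continuous_swap

/-- Needed so that the mapping cylinder inside `X × I` is an admissible target for the homotopy
extension property. -/
lemma compactlyGeneratedSpace_of_isClosed_subtype {s : Set X} (hs : IsClosed s) :
    CompactlyGeneratedSpace s := by
  refine compactlyGeneratedSpace_of_isClosed fun t ht => ?_
  rw [hs.isClosedEmbedding_subtypeVal.isClosed_iff_image_isClosed]
  refine CompactlyGeneratedSpace.isClosed' fun K _ _ _ f hf => ?_
  have hK : IsClosed (f ⁻¹' s) := hs.preimage hf
  have : CompactSpace (f ⁻¹' s) := isCompact_iff_compactSpace.mp hK.isCompact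
  have h1 := ht (f ⁻¹' s) (fun k => ⟨f k, k.2⟩) (by fun_prop)
  convert hK.isClosedEmbedding_subtypeVal.isClosedMap _ h1 using 1
  ext k
  simp only [Set.mem_preimage, Set.mem_image, Subtype.exists, exists_and_right, exists_eq_right]

/-- A closed cofibration admits a retraction onto its mapping cylinder. -/
lemma IsClosedCofibration.exists_retraction {A : Type u} [TopologicalSpace A] {f : C(A, X)}
    (hf : IsClosedCofibration f) : ∃ r : C(X × I, X × I), (∀ x, r (x, 0) = (x, 0)) ∧
      (∀ a t, r (f a, t) = (f a, t)) ∧ ∀ z, (r z).2 = 0 ∨ (r z).1 ∈ Set.range f := by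
  obtain ⟨hcl, hext⟩ := hf
  let M : Set (X × I) := {z | z.2 = 0 ∨ z.1 ∈ Set.range f}
  have hM : IsClosed M := (isClosed_eq continuous_snd continuous_const).union
    (hcl.isClosed_range.preimage continuous_fst)
  have := compactlyGeneratedSpace_of_isClosed_subtype hM
  obtain ⟨G, hG0, hG1⟩ := hext M ⟨fun x => ⟨(x, 0), Or.inl rfl⟩, by fun_prop⟩
    ⟨fun z => ⟨(f z.1, z.2), Or.inr ⟨z.1, rfl⟩⟩, by fun_prop⟩ fun _ => rfl
  refine ⟨⟨fun z => (G z).1, by fun_prop⟩, fun x => ?_, fun a t => ?_, fun z => (G z).2⟩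
  · exact congrArg Subtype.val (hG0 x)
  · exact congrArg Subtype.val (hG1 a t)

end CompactlyGenerated

/-! ### Concatenation of paths in families. -/

section Concat

/-- The concatenation of three paths. -/
noncomputable def concat₃ {Z : Type*} (a b c : I → Z) (u : I) : Z :=
  if (u : ℝ) ≤ 1 / 3 then a (Set.projIcc 0 1 zero_le_one (3 * u))
  else if (u : ℝ) ≤ 2 / 3 then b (Set.projIcc 0 1 zero_le_one (3 * u - 1))
  else c (Set.projIcc 0 1 zero_le_one (3 * u - 2))

lemma concat₃_zero {Z : Type*} (a b c : I → Z) : concat₃ a b c 0 = a 0 := by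
  simp [concat₃]

lemma concat₃_one {Z : Type*} (a b c : I → Z) : concat₃ a b c 1 = c 1 := by
  rw [concat₃, if_neg (by norm_num), if_neg (by norm_num)]
  norm_num

lemma concat₃_comp {Z W : Type*} (f : Z → W) (a b c : I → Z) (u : I) :
    concat₃ (fun t => f (a t)) (fun t => f (b t)) (fun t => f (c t)) u = f (concat₃ a b c u) := by
  simp only [concat₃]
  split_ifs <;> rfl

lemma concat₃_const {Z : Type*} (z : Z) (u : I) :
    concat₃ (fun _ => z) (fun _ => z) (fun _ => z) u = z :=
  concat₃_comp (fun _ : I => z) id id id u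

lemma continuous_concat₃ {A Z : Type*} [TopologicalSpace A] [TopologicalSpace Z] {a b c : A → I → Z}
    (ha : Continuous fun p : A × I => a p.1 p.2) (hb : Continuous fun p : A × I => b p.1 p.2)
    (hc : Continuous fun p : A × I => c p.1 p.2) (hab : ∀ x, a x 1 = b x 0)
    (hbc : ∀ x, b x 1 = c x 0) : Continuous fun p : A × I => concat₃ (a p.1) (b p.1) (c p.1) p.2 := by
  have hproj : Continuous (Set.projIcc (0 : ℝ) 1 zero_le_one) := continuous_projIcc
  refine Continuous.if_le ?_ (Continuous.if_le ?_ ?_ (by fun_prop) continuous_const ?_)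
    (by fun_prop) continuous_const ?_
  · exact ha.comp (continuous_fst.prodMk (hproj.comp (by fun_prop)))
  · exact hb.comp (continuous_fst.prodMk (hproj.comp (by fun_prop)))
  · exact hc.comp (continuous_fst.prodMk (hproj.comp (by fun_prop)))
  · rintro ⟨x, u⟩ (hu : (u : ℝ) = 2 / 3)
    simp only [hu]
    norm_num
    exact hbc x
  · rintro ⟨x, u⟩ (hu : (u : ℝ) = 1 / 3)
    simp only [hu]
    norm_num
    exact hab x

end Concat

/-! ### Lifting paths through a covering with group. -/

section Lifting

variable {F T R : Type*} [Group F] [MulAction F T] [TopologicalSpace T] [TopologicalSpace R]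
  {p : T → R}

lemma continuous_liftPath_family (cov : IsCoveringMap p) {K : Type*} [TopologicalSpace K]
    {γ : K → C(I, R)} (hγ : Continuous fun q : K × I => γ q.1 q.2) {e : K → T} (he : Continuous e)
    (h0 : ∀ k, γ k 0 = p (e k)) : Continuous fun q : K × I => cov.liftPath (γ q.1) (e q.1) (h0 q.1) q.2 := by
  have : Continuous fun q : I × K => cov.liftPath (γ q.2) (e q.2) (h0 q.2) q.1 := by
    refine cov.isLocalHomeomorph.continuous_lift cov.isSeparatedMap
      ⟨fun q : I × K => γ q.2 q.1, hγ.comp continuous_swap⟩ ?_ ?_ fun k => ?_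
    · funext q
      exact congrFun (cov.liftPath_lifts (γ q.2) (e q.2) (h0 q.2)) q.1
    · simpa only [cov.liftPath_zero] using he
    · exact (cov.liftPath (γ k) (e k) (h0 k)).continuous
  exact this.comp continuous_swap

lemma liftPath_apply (cov : IsCoveringMap p) {γ : C(I, R)} {e : T} (h0 : γ 0 = p e) (t : I) :
    p (cov.liftPath γ e h0 t) = γ t := congrFun (cov.liftPath_lifts γ e h0) t

lemma smul_liftPath (hp : IsQuotientCoveringMap p F) {γ : C(I, R)} {e : T} (h0 : γ 0 = p e) (w : F)
    (h0' : γ 0 = p (w • e)) (t : I) :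
    hp.isCoveringMap.liftPath γ (w • e) h0' t = w • hp.isCoveringMap.liftPath γ e h0 t := by
  have := hp.toContinuousConstSMul
  have h := (hp.isCoveringMap.eq_liftPath_iff (γ := γ) (e := w • e) h0'
    (Γ := fun t => w • hp.isCoveringMap.liftPath γ e h0 t)).mpr ⟨?_, ?_, ?_⟩
  · exact (congrFun h t).symm
  · exact (hp.isCoveringMap.liftPath γ e h0).continuous.const_smul w
  · funext t
    exact (hp.map_smul w).trans (liftPath_apply _ h0 t)
  · simp only [hp.isCoveringMap.liftPath_zero]

open Classical in
/-- The element of the group that takes `x` to `y`. -/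
noncomputable def translation (F : Type*) {T : Type*} [Group F] [MulAction F T] (x y : T) : F :=
  if h : ∃ w : F, y = w • x then h.choose else 1

lemma translation_smul (hp : IsQuotientCoveringMap p F) {x y : T} (h : p x = p y) :
    translation F x y • x = y := by
  have h' : ∃ w : F, y = w • x := by
    obtain ⟨w, hw⟩ := hp.apply_eq_iff_mem_orbit.mp h.symm
    exact ⟨w, hw.symm⟩
  rw [translation, dif_pos h']
  exact h'.choose_spec.symm

lemma smul_right_injective_of_cover (hp : IsQuotientCoveringMap p F) {v w : F} {x : T}
    (h : v • x = w • x) : v = w :=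
  have := hp.isCancelSMul
  IsCancelSMul.right_cancel _ _ _ h

/-- Near `k`, the points `a k'` and `b k'` translated back by the element at `k` stay in one set
that meets none of its nontrivial translates. -/
lemma isLocallyConstant_translation (hp : IsQuotientCoveringMap p F) {K : Type*}
    [TopologicalSpace K] {a b : K → T} (ha : Continuous a) (hb : Continuous b)
    (h : ∀ k, p (a k) = p (b k)) : IsLocallyConstant fun k => translation F (a k) (b k) := by
  have := hp.toContinuousConstSMul
  rw [IsLocallyConstant.iff_eventually_eq]
  intro k
  obtain ⟨U, hU, hdisj⟩ := hp.disjoint (a k)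
  have h1 : ∀ᶠ k' in nhds k, a k' ∈ U := ha.continuousAt hU
  have hcont : Continuous fun k' => (translation F (a k) (b k))⁻¹ • b k' := hb.const_smul _
  have h2 : ∀ᶠ k' in nhds k, (translation F (a k) (b k))⁻¹ • b k' ∈ U := by
    refine hcont.continuousAt (x := k) ?_
    rwa [inv_smul_eq_iff.mpr (translation_smul hp (h k)).symm]
  filter_upwards [h1, h2] with k' h1 h2
  have h3 := hdisj ((translation F (a k) (b k))⁻¹ * translation F (a k') (b k'))
    ⟨_, ⟨a k', h1, rfl⟩, ?_⟩
  · exact (inv_mul_eq_one.mp h3).symm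
  · simpa only [mul_smul, translation_smul hp (h k')] using h2

end Lifting

/-! ### Lifts of self-maps and their discrete invariants. -/

/-- Data that relate a space `S` with a subspace `P` to the base of a combed covering: `S` is
dominated by `C × R`, and each component of `C × R` has a chosen path from a point of `P`. -/
structure Domination (F T R C : Type*) {S : Type*} [Group F] [MulAction F T] [TopologicalSpace T]
    [TopologicalSpace R] [TopologicalSpace C] [TopologicalSpace S] (P : Set S) where
  p : T → R
  comb : T → T → I → T
  cover : IsCombedCover (F := F) p comb
  φ : C(S, R)
  l : C(S, C)
  ψ : C(C × R, S)
  h : (ContinuousMap.id S).Homotopy (ψ.comp (l.prodMk φ))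
  x₀ : T
  -- Every map in question fixes `z c`, so the single point `y c` starts the lifts for all of them
  -- and normalises them continuously.
  z : C → S
  z_mem : ∀ c, z c ∈ P
  δ : ∀ c, Path (z c) (ψ (c, p x₀))
  y : C → T
  p_y : ∀ c, p (y c) = φ (z c)
  meets : ∀ s, ∃ z ∈ P, Joined s z

/-- The self-maps of `S` that fix `P` pointwise. -/
def FixMap {S : Type*} [TopologicalSpace S] (P : Set S) : Type _ := {g : C(S, S) // ∀ s ∈ P, g s = s}

instance {S : Type*} [TopologicalSpace S] (P : Set S) : FunLike (FixMap P) S S where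
  coe g := g.1
  coe_injective _ _ h := Subtype.ext (DFunLike.coe_injective h)

lemma FixMap.continuous {S : Type*} [TopologicalSpace S] {P : Set S} (g : FixMap P) : Continuous g :=
  g.1.continuous

attribute [fun_prop] FixMap.continuous

lemma FixMap.apply_of_mem {S : Type*} [TopologicalSpace S] {P : Set S} (g : FixMap P) {s : S}
    (hs : s ∈ P) : g s = s := g.2 s hs

namespace Domination

variable {F T R C S : Type*} [Group F] [MulAction F T] [TopologicalSpace T]
    [TopologicalSpace R] [TopologicalSpace C] [TopologicalSpace S] {P : Set S}
    (D : Domination F T R C P)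

include D in
lemma quot : IsQuotientCoveringMap D.p F := D.cover.toIsQuotientCoveringMap

include D in
lemma cov : IsCoveringMap D.p := D.quot.isCoveringMap

@[fun_prop]
lemma continuous_p : Continuous D.p := D.cov.continuous

lemma continuous_comb {A : Type*} [TopologicalSpace A] {a b : A → T} {c : A → I} (ha : Continuous a)
    (hb : Continuous b) (hc : Continuous c) : Continuous fun x => D.comb (a x) (b x) (c x) :=
  D.cover.continuous_comb.comp (ha.prodMk (hb.prodMk hc))

include D in
lemma pathConnectedSpace : PathConnectedSpace T where
  nonempty := ⟨D.x₀⟩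
  joined x y := ⟨⟨⟨fun t => D.comb x y t, D.continuous_comb continuous_const continuous_const
    continuous_id⟩, D.cover.comb_zero x y, D.cover.comb_one x y⟩⟩

lemma h_zero (s : S) : D.h (0, s) = s := D.h.apply_zero s

lemma h_one (s : S) : D.h (1, s) = D.ψ (D.l s, D.φ s) := D.h.apply_one s

/-- The path in the base along which the first lift is taken. -/
def basePath (g : FixMap P) (c : C) : C(I, R) := ⟨fun u => D.φ (g (D.δ c u)), by fun_prop⟩

lemma basePath_zero (g : FixMap P) (c : C) : D.basePath g c 0 = D.p (D.y c) := by
  simp [basePath, g.apply_of_mem (D.z_mem c), D.p_y]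

/-- The lift of `φ g ψ (c, x₀)`. -/
noncomputable def baseLift (g : FixMap P) (c : C) : T :=
  D.cov.liftPath (D.basePath g c) (D.y c) (D.basePath_zero g c) 1

lemma p_baseLift (g : FixMap P) (c : C) : D.p (D.baseLift g c) = D.φ (g (D.ψ (c, D.p D.x₀))) := by
  rw [baseLift, liftPath_apply D.cov]
  simp [basePath]

/-- The image under `φ g ψ` of the chosen path from `x₀` to `x`. -/
noncomputable def treePath (g : FixMap P) (c : C) (x : T) : C(I, R) :=
  ⟨fun u => D.φ (g (D.ψ (c, D.p (D.comb D.x₀ x u)))), by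
    have := D.continuous_comb (a := fun _ => D.x₀) (b := fun _ => x) continuous_const
      continuous_const continuous_id
    fun_prop⟩

lemma treePath_zero (g : FixMap P) (c : C) (x : T) :
    D.treePath g c x 0 = D.p (D.baseLift g c) := by
  rw [p_baseLift]
  simp [treePath, D.cover.comb_zero]

/-- The lift of `x ↦ φ g ψ (c, x)` to the total space. -/
noncomputable def treeLift (g : FixMap P) (c : C) (x : T) : T :=
  D.cov.liftPath (D.treePath g c x) (D.baseLift g c) (D.treePath_zero g c x) 1

lemma p_treeLift (g : FixMap P) (c : C) (x : T) :
    D.p (D.treeLift g c x) = D.φ (g (D.ψ (c, D.p x))) := by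
  rw [treeLift, liftPath_apply D.cov]
  simp [treePath, D.cover.comb_one]

/-- The pullback of the covering to `S`. -/
abbrev Pullback : Type _ := {q : S × T // D.p q.2 = D.φ q.1}

/-- The image under `φ g` of the chosen path from `ψ (l s, φ s)` to `s`. -/
noncomputable def trackPath (g : FixMap P) (s : S) : C(I, R) :=
  ⟨fun u => D.φ (g (D.h (σ u, s))), by fun_prop⟩

lemma trackPath_zero (g : FixMap P) (q : D.Pullback) :
    D.trackPath g q.1.1 0 = D.p (D.treeLift g (D.l q.1.1) q.1.2) := by
  rw [p_treeLift, q.2]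
  simp [trackPath]

/-- The lift of `(s, x) ↦ φ g s` to the total space. -/
noncomputable def lift (g : FixMap P) (q : D.Pullback) : T :=
  D.cov.liftPath (D.trackPath g q.1.1) _ (D.trackPath_zero g q) 1

lemma p_lift (g : FixMap P) (q : D.Pullback) : D.p (D.lift g q) = D.φ (g q.1.1) := by
  rw [lift, liftPath_apply D.cov]
  simp [trackPath]

section Families

variable {K : Type*} [TopologicalSpace K] {g : K → FixMap P}
  (hg : Continuous fun q : K × S => g q.1 q.2)

include hg

lemma continuous_family_comp {A : Type*} [TopologicalSpace A] {a : A → K} {b : A → S}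
    (ha : Continuous a) (hb : Continuous b) : Continuous fun x => g (a x) (b x) :=
  hg.comp (ha.prodMk hb)

lemma continuous_baseLift (c : C) : Continuous fun k => D.baseLift (g k) c := by
  have := continuous_liftPath_family D.cov (γ := fun k => D.basePath (g k) c)
    (D.φ.continuous.comp (continuous_family_comp hg continuous_fst
      ((D.δ c).continuous.comp continuous_snd))) (e := fun _ => D.y c) continuous_const
      fun k => D.basePath_zero (g k) c
  exact this.comp (Continuous.prodMk_left 1)

lemma continuous_treeLift (c : C) : Continuous fun q : K × T => D.treeLift (g q.1) c q.2 := by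
  have hcomb : Continuous fun q : (K × T) × I => D.comb D.x₀ q.1.2 q.2 :=
    D.continuous_comb continuous_const (by fun_prop) continuous_snd
  have := continuous_liftPath_family D.cov (γ := fun q : K × T => D.treePath (g q.1) c q.2)
    (D.φ.continuous.comp (continuous_family_comp hg (by fun_prop) (by fun_prop)))
    (e := fun q => D.baseLift (g q.1) c) ((D.continuous_baseLift hg c).comp continuous_fst)
    fun q => D.treePath_zero (g q.1) c q.2
  exact this.comp (Continuous.prodMk_left 1)

lemma continuous_lift [DiscreteTopology C] :
    Continuous fun q : K × D.Pullback => D.lift (g q.1) q.2 := by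
  have h1 : Continuous fun q : C × (K × T) => D.treeLift (g q.2.1) q.1 q.2.2 :=
    continuous_prod_of_discrete_left.mpr fun c => D.continuous_treeLift hg c
  have hval : Continuous fun q : D.Pullback => q.1 := continuous_subtype_val
  have := continuous_liftPath_family D.cov
    (γ := fun q : K × D.Pullback => D.trackPath (g q.1) q.2.1.1)
    (D.φ.continuous.comp (continuous_family_comp hg (by fun_prop) (by fun_prop)))
    (e := fun q => D.treeLift (g q.1) (D.l q.2.1.1) q.2.1.2)
    (h1.comp (f := fun q : K × D.Pullback => (D.l q.2.1.1, (q.1, q.2.1.2))) (by fun_prop))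
    fun q => D.trackPath_zero (g q.1) q.2
  exact this.comp (Continuous.prodMk_left 1)

end Families

lemma continuous_const_family (g : FixMap P) :
    Continuous fun q : PUnit.{1} × S => (fun _ : PUnit => g) q.1 q.2 := by
  fun_prop

lemma continuous_treeLift_apply (g : FixMap P) (c : C) : Continuous (D.treeLift g c) :=
  (D.continuous_treeLift (g := fun _ : PUnit => g) (continuous_const_family g) c).comp (Continuous.prodMk_right PUnit.unit)

lemma continuous_lift_apply [DiscreteTopology C] (g : FixMap P) : Continuous (D.lift g) :=
  (D.continuous_lift (g := fun _ : PUnit => g) (continuous_const_family g)).comp (Continuous.prodMk_right PUnit.unit)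

/-- The effect of `g` on loops. -/
noncomputable def holonomy (g : FixMap P) (c : C) (w : F) : F :=
  translation F (D.treeLift g c D.x₀) (D.treeLift g c (w • D.x₀))

lemma p_treeLift_smul (g : FixMap P) (c : C) (w : F) (x : T) :
    D.p (D.treeLift g c x) = D.p (D.treeLift g c (w • x)) := by
  rw [p_treeLift, p_treeLift, D.quot.map_smul]

/-- Both sides lift the same map on the connected space `T` and agree at `x₀`. -/
lemma treeLift_smul (g : FixMap P) (c : C) (w : F) (x : T) :
    D.treeLift g c (w • x) = D.holonomy g c w • D.treeLift g c x := by
  have := D.pathConnectedSpace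
  have := D.quot.toContinuousConstSMul
  refine congrFun (D.cov.eq_of_comp_eq (g₁ := fun x => D.treeLift g c (w • x))
    (g₂ := fun x => D.holonomy g c w • D.treeLift g c x)
    ((D.continuous_treeLift_apply g c).comp (continuous_const_smul w))
    ((D.continuous_treeLift_apply g c).const_smul _) ?_ D.x₀ ?_) x
  · funext x
    simp only [Function.comp_apply]
    rw [D.quot.map_smul, ← D.p_treeLift_smul]
  · exact (translation_smul D.quot (D.p_treeLift_smul g c w D.x₀)).symm

/-- The effect of `g` on loops, as a homomorphism. -/
noncomputable def holonomyHom (g : FixMap P) (c : C) : F →* F :=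
  MonoidHom.mk' (D.holonomy g c) fun v w => smul_right_injective_of_cover D.quot
    (x := D.treeLift g c D.x₀) (by
      rw [← treeLift_smul, mul_smul, treeLift_smul, treeLift_smul, mul_smul])

/-- The action on the pullback. -/
def smulPullback (w : F) (q : D.Pullback) : D.Pullback :=
  ⟨(q.1.1, w • q.1.2), by rw [D.quot.map_smul]; exact q.2⟩

lemma lift_smul (g : FixMap P) (w : F) (q : D.Pullback) :
    D.lift g (D.smulPullback w q) = D.holonomy g (D.l q.1.1) w • D.lift g q := by
  have h := D.trackPath_zero g (D.smulPullback w q)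
  simp only [smulPullback] at h
  have key : ∀ (e : T) (h' : D.trackPath g q.1.1 0 = D.p e),
      e = D.holonomy g (D.l q.1.1) w • D.treeLift g (D.l q.1.1) q.1.2 →
      D.cov.liftPath (D.trackPath g q.1.1) e h' 1 =
        D.holonomy g (D.l q.1.1) w • D.lift g q := by
    rintro e h' rfl
    exact smul_liftPath D.quot (D.trackPath_zero g q) _ h' 1
  exact key _ _ (D.treeLift_smul g _ w q.1.2)

lemma eq_smulPullback (q q' : D.Pullback) (h : q.1.1 = q'.1.1) : ∃ w : F, q' = D.smulPullback w q := by
  have h1 : D.p q.1.2 = D.p q'.1.2 := by rw [q.2, q'.2, h]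
  refine ⟨translation F q.1.2 q'.1.2, Subtype.ext (Prod.ext h.symm ?_)⟩
  exact (translation_smul D.quot h1).symm

/-- The discrete invariant of `g`: its effect on generators of the group, and on the points `q j`
of the pullback. -/
noncomputable def invariant {ι J : Type*} (gen : ι → F) (q : J → D.Pullback) (g : FixMap P) :
    (C × ι → F) × (J → F) :=
  (fun i => D.holonomy g i.1 (gen i.2), fun j => translation F (q j).1.2 (D.lift g (q j)))

/-- Each entry is a translation between two continuous families of points in a common fibre, and
there are finitely many entries. -/
lemma isLocallyConstant_invariant [DiscreteTopology C] [Finite C] {ι J : Type*} [Finite ι] [Finite J]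
    (gen : ι → F) {q : J → D.Pullback} (hq : ∀ j, (q j).1.1 ∈ P) {K : Type*} [TopologicalSpace K]
    {g : K → FixMap P} (hg : Continuous fun q : K × S => g q.1 q.2) :
    IsLocallyConstant fun k => D.invariant gen q (g k) := by
  refine IsLocallyConstant.prodMk ?_ ?_
  · rw [IsLocallyConstant.iff_eventually_eq]
    intro k
    have : ∀ i : C × ι, ∀ᶠ k' in nhds k, D.holonomy (g k') i.1 (gen i.2) =
        D.holonomy (g k) i.1 (gen i.2) := fun i =>
      (isLocallyConstant_translation D.quot
        ((D.continuous_treeLift hg i.1).comp (Continuous.prodMk_left D.x₀))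
        ((D.continuous_treeLift hg i.1).comp (Continuous.prodMk_left (gen i.2 • D.x₀)))
        fun k => D.p_treeLift_smul (g k) i.1 _ _).eventually_eq k
    filter_upwards [Filter.eventually_all.mpr this] with k' hk'
    exact funext hk'
  · rw [IsLocallyConstant.iff_eventually_eq]
    intro k
    have : ∀ j, ∀ᶠ k' in nhds k, translation F (q j).1.2 (D.lift (g k') (q j)) =
        translation F (q j).1.2 (D.lift (g k) (q j)) := fun j =>
      (isLocallyConstant_translation D.quot (a := fun _ => (q j).1.2) continuous_const
        ((D.continuous_lift hg).comp (Continuous.prodMk_left (q j)))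
        fun k => by
          rw [Function.comp_apply, p_lift, (q j).2, (g k).apply_of_mem (hq j)]).eventually_eq k
    filter_upwards [Filter.eventually_all.mpr this] with k' hk'
    exact funext hk'

lemma holonomy_eq_of_invariant {ι J : Type*} {gen : ι → F}
    (hgen : Subgroup.closure (Set.range gen) = ⊤) {q : J → D.Pullback} {f g : FixMap P}
    (h : D.invariant gen q f = D.invariant gen q g) (c : C) (w : F) :
    D.holonomy f c w = D.holonomy g c w := by
  have : D.holonomyHom f c = D.holonomyHom g c := by
    refine MonoidHom.eq_of_eqOn_dense hgen ?_
    rintro _ ⟨i, rfl⟩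
    exact congrFun (congrArg Prod.fst h) (c, i)
  exact DFunLike.congr_fun this w

/-- The lifts agree at `q j`, hence on its whole fibre by equivariance. Along a path in `P` both
maps are the identity, so the two lifts cover the same path and agreement at one end propagates to
the other. -/
lemma lift_eq_of_invariant [DiscreteTopology C] {ι J : Type*} {gen : ι → F}
    (hgen : Subgroup.closure (Set.range gen) = ⊤) {q : J → D.Pullback} (hq : ∀ j, (q j).1.1 ∈ P)
    (hP : ∀ s ∈ P, ∃ j, JoinedIn P s (q j).1.1) {f g : FixMap P}
    (h : D.invariant gen q f = D.invariant gen q g) {x : D.Pullback} (hx : x.1.1 ∈ P) :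
    D.lift f x = D.lift g x := by
  obtain ⟨j, hj⟩ := hP _ hx
  let β := hj.somePath
  have hβ : ∀ t, β t ∈ P := hj.somePath_mem
  let γ : C(I, R) := D.φ.comp β.toContinuousMap
  have hγ0 : γ 0 = D.p x.1.2 := by rw [x.2]; simp [γ]
  let Γ := D.cov.liftPath γ x.1.2 hγ0
  let path : I → D.Pullback := fun t => ⟨(β t, Γ t), liftPath_apply D.cov hγ0 t⟩
  have hpath : Continuous path := by
    refine Continuous.subtype_mk ?_ _
    fun_prop
  have hpath0 : path 0 = x := Subtype.ext (Prod.ext β.source (D.cov.liftPath_zero γ _ hγ0))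
  have hlift (f : FixMap P) : D.p (D.lift f (q j)) = D.p (q j).1.2 := by
    rw [p_lift, (q j).2, f.apply_of_mem (hq j)]
  have hj : D.lift f (q j) = D.lift g (q j) := by
    rw [← translation_smul D.quot (hlift f).symm, ← translation_smul D.quot (hlift g).symm]
    congr 1
    exact congrFun (congrArg Prod.snd h) j
  have h1 : D.lift f (path 1) = D.lift g (path 1) := by
    obtain ⟨w, hw⟩ := D.eq_smulPullback (q j) (path 1) β.target.symm
    rw [hw, lift_smul, lift_smul, hj, D.holonomy_eq_of_invariant hgen h]
  have := congrFun (D.cov.eq_of_comp_eq ((D.continuous_lift_apply f).comp hpath)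
    ((D.continuous_lift_apply g).comp hpath) (by
      funext t
      simp only [Function.comp_apply, p_lift]
      rw [f.apply_of_mem (hβ t), g.apply_of_mem (hβ t)]) 1 h1) 0
  simpa only [Function.comp_apply, hpath0] using this

end Domination

/-! ### The relative homotopy between matching maps. -/

namespace Domination

variable {F T R C S : Type*} [Group F] [MulAction F T] [TopologicalSpace T]
    [TopologicalSpace R] [TopologicalSpace C] [TopologicalSpace S] {P : Set S}
    (D : Domination F T R C P)

/-- Two maps match if they have the same effect on loops and if their lifts agree over `P`. -/
structure Matches (f g : FixMap P) : Prop where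
  holonomy : ∀ c w, D.holonomy f c w = D.holonomy g c w
  lift : ∀ x : D.Pullback, x.1.1 ∈ P → D.lift f x = D.lift g x

/-- A point of the pullback over `s`. -/
noncomputable def pt (s : S) : D.Pullback :=
  ⟨(s, (D.quot.surjective (D.φ s)).choose), (D.quot.surjective (D.φ s)).choose_spec⟩

/-- The homotopy from `φ f` to `φ g` along the chosen paths in the total space. -/
noncomputable def mid (f g : FixMap P) (s : S) (t : I) : R :=
  D.p (D.comb (D.lift f (D.pt s)) (D.lift g (D.pt s)) t)

variable {D}

/-- Changing the point of the fibre translates both lifts by the same group element, as the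
holonomies agree, and the combing is equivariant. -/
lemma Matches.mid_eq {f g : FixMap P} (h : D.Matches f g) (q : D.Pullback) (t : I) :
    D.mid f g q.1.1 t = D.p (D.comb (D.lift f q) (D.lift g q) t) := by
  obtain ⟨w, hw⟩ := D.eq_smulPullback (D.pt q.1.1) q rfl
  rw [mid, hw, lift_smul, lift_smul, ← h.holonomy, D.cover.comb_smul, D.quot.map_smul]
  rfl

lemma mid_zero (f g : FixMap P) (s : S) : D.mid f g s 0 = D.φ (f s) := by
  rw [mid, D.cover.comb_zero, p_lift]; rfl

lemma mid_one (f g : FixMap P) (s : S) : D.mid f g s 1 = D.φ (g s) := by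
  rw [mid, D.cover.comb_one, p_lift]; rfl

lemma Matches.mid_of_mem {f g : FixMap P} (h : D.Matches f g) {s : S} (hs : s ∈ P) (t : I) :
    D.mid f g s t = D.φ s := by
  rw [mid, h.lift _ hs, D.cover.comb_self, p_lift]
  exact congrArg D.φ (g.apply_of_mem hs)

/-- Openness is inherited from `p`. Unlike general quotient maps, open ones remain quotient maps
after products, so continuity of `mid` in families can be checked on the pullback. -/
lemma isOpenQuotientMap_pullback : IsOpenQuotientMap fun q : D.Pullback => q.1.1 where
  surjective s := ⟨D.pt s, rfl⟩
  continuous := by fun_prop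
  isOpenMap := by
    intro W hW
    rw [isOpen_iff_mem_nhds]
    rintro _ ⟨⟨⟨s, x⟩, hq⟩, hW', rfl⟩
    obtain ⟨O, hO, rfl⟩ := isOpen_induced_iff.mp hW
    obtain ⟨A, B, hA, hB, hsA, hxB, hAB⟩ := isOpen_prod_iff.mp hO s x hW'
    have h1 : IsOpen (A ∩ D.φ ⁻¹' (D.p '' B)) :=
      hA.inter ((D.cov.isOpenMap B hB).preimage D.φ.continuous)
    refine Filter.mem_of_superset (h1.mem_nhds ⟨hsA, x, hxB, hq⟩) ?_
    rintro s' ⟨hs', x', hx', hpx'⟩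
    exact ⟨⟨(s', x'), hpx'⟩, hAB ⟨hs', hx'⟩, rfl⟩

section Families

variable {K : Type*} [TopologicalSpace K] {f g : K → FixMap P}
  (hf : Continuous fun q : K × S => f q.1 q.2) (hg : Continuous fun q : K × S => g q.1 q.2)
  (h : ∀ k, D.Matches (f k) (g k))

include hf hg h

lemma continuous_mid [DiscreteTopology C] :
    Continuous fun q : (K × S) × I => D.mid (f q.1.1) (g q.1.1) q.1.2 q.2 := by
  have hquot := (IsOpenQuotientMap.id (X := K)).prodMap (isOpenQuotientMap_pullback (D := D))
  have hquot := hquot.prodMap (IsOpenQuotientMap.id (X := I))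
  rw [← hquot.continuous_comp_iff]
  have : Continuous fun q : (K × D.Pullback) × I =>
      D.p (D.comb (D.lift (f q.1.1) q.1.2) (D.lift (g q.1.1) q.1.2) q.2) :=
    D.continuous_p.comp (D.continuous_comb ((D.continuous_lift hf).comp continuous_fst)
      ((D.continuous_lift hg).comp continuous_fst) continuous_snd)
  refine this.congr fun q => ?_
  exact ((h q.1.1).mid_eq q.1.2 q.2).symm

end Families

/-- A path from `s` to `P` and its image under `g` have the same end in `P`, and `l` is constant on
paths. -/
lemma l_apply [DiscreteTopology C] (g : FixMap P) (s : S) : D.l (g s) = D.l s := by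
  have hl : ∀ {x y : S}, Joined x y → D.l x = D.l y := by
    rintro x y ⟨γ⟩
    have := PreconnectedSpace.constant inferInstance (D.l.continuous.comp γ.continuous) (x := 0) (y := 1)
    simpa using this
  obtain ⟨z, hz, hsz⟩ := D.meets s
  have h1 := hl (hsz.map g.continuous)
  rw [g.apply_of_mem hz] at h1
  rw [h1, hl hsz]

variable (D)

/-- A homotopy from `f` to `g` that is not constant on `P`. -/
noncomputable def rough (f g : FixMap P) (s : S) (u : I) : S :=
  concat₃ (fun t => D.h (t, f s)) (fun t => D.ψ (D.l s, D.mid f g s t)) (fun t => D.h (σ t, g s)) u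

/-- The function that goes from `0` to `1` and back. -/
noncomputable def tent (u : I) : I := concat₃ id (fun _ => 1) σ u

lemma tent_zero : tent 0 = 0 := concat₃_zero _ _ _

lemma tent_one : tent 1 = 0 := (concat₃_one _ _ _).trans unitInterval.symm_one

lemma continuous_tent : Continuous tent := by
  have := continuous_concat₃ (A := Unit) (a := fun _ => id) (b := fun _ _ => 1) (c := fun _ => σ)
    (by fun_prop) (by fun_prop) (by fun_prop) (fun _ => rfl) fun _ => by simp
  exact this.comp (Continuous.prodMk_right ())

/-- The extension of the homotopy `rough` and of its contraction over `P`, to be composed with a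
retraction onto the mapping cylinder. -/
noncomputable def cylinderHomotopy (f g : FixMap P) (z : S × I) (u : I) : S :=
  open Classical in if z.2 = 0 then D.rough f g z.1 u else D.h (σ z.2 * tent u, z.1)

variable {D}

lemma rough_zero (f g : FixMap P) (s : S) : D.rough f g s 0 = f s := by
  rw [rough, concat₃_zero, h_zero]

lemma rough_one (f g : FixMap P) (s : S) : D.rough f g s 1 = g s := by
  rw [rough, concat₃_one, unitInterval.symm_one, h_zero]

/-- Over `P` the middle part is constant, which leaves the track of `h` out and back. -/
lemma Matches.rough_of_mem {f g : FixMap P} (h : D.Matches f g) {s : S} (hs : s ∈ P) (u : I) :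
    D.rough f g s u = D.h (tent u, s) := by
  rw [rough, f.apply_of_mem hs, g.apply_of_mem hs, tent,
    ← concat₃_comp (fun t => D.h (t, s)) id (fun _ => 1) σ]
  simp only [h.mid_of_mem hs, h_one, id]

lemma Matches.cylinderHomotopy_of_mem {f g : FixMap P} (h : D.Matches f g) {z : S × I}
    (hz : z.1 ∈ P) (u : I) : D.cylinderHomotopy f g z u = D.h (σ z.2 * tent u, z.1) := by
  rw [cylinderHomotopy]
  split_ifs with h0
  · rw [h0, unitInterval.symm_zero, one_mul, h.rough_of_mem hz]
  · rfl

lemma cylinderHomotopy_zero (f g : FixMap P) (s : S) (u : I) :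
    D.cylinderHomotopy f g (s, 0) u = D.rough f g s u := if_pos rfl

section Families

variable {K : Type*} [TopologicalSpace K] {f g : K → FixMap P}
  (hf : Continuous fun q : K × S => f q.1 q.2) (hg : Continuous fun q : K × S => g q.1 q.2)
  (h : ∀ k, D.Matches (f k) (g k))

include hf hg h

lemma continuous_rough [DiscreteTopology C] :
    Continuous fun q : (K × S) × I => D.rough (f q.1.1) (g q.1.1) q.1.2 q.2 := by
  refine continuous_concat₃ (a := fun (q : K × S) t => D.h (t, f q.1 q.2))
    (b := fun (q : K × S) t => D.ψ (D.l q.2, D.mid (f q.1) (g q.1) q.2 t))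
    (c := fun (q : K × S) t => D.h (σ t, g q.1 q.2)) ?_ ?_ ?_ (fun q => ?_) fun q => ?_
  · exact D.h.continuous.comp (continuous_snd.prodMk (hf.comp continuous_fst))
  · exact D.ψ.continuous.comp ((D.l.continuous.comp (continuous_snd.comp continuous_fst)).prodMk
      (continuous_mid hf hg h))
  · exact D.h.continuous.comp ((unitInterval.continuous_symm.comp continuous_snd).prodMk
      (hg.comp continuous_fst))
  · simp only [mid_zero, h_one, l_apply]
  · simp only [mid_one, unitInterval.symm_zero, h_one, l_apply]

/-- The two formulas live on closed sets and agree on the overlap because the maps match. -/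
lemma continuous_cylinderHomotopy [DiscreteTopology C] (hP : IsClosed P) {r : C(S × I, S × I)}
    (hr : ∀ z, (r z).2 = 0 ∨ (r z).1 ∈ P) : Continuous fun q : (K × (S × I)) × I =>
      D.cylinderHomotopy (f q.1.1) (g q.1.1) (r q.1.2) q.2 := by
  rw [← continuousOn_univ]
  have hcover : {q : (K × (S × I)) × I | (r q.1.2).2 = 0} ∪ {q | (r q.1.2).1 ∈ P} = Set.univ :=
    Set.eq_univ_of_forall fun q => hr q.1.2
  rw [← hcover]
  refine ContinuousOn.union_of_isClosed ?_ ?_ (isClosed_eq (by fun_prop) continuous_const)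
    (hP.preimage (by fun_prop))
  · have := (continuous_rough hf hg h).comp (f := fun q : (K × (S × I)) × I =>
      ((q.1.1, (r q.1.2).1), q.2)) (by fun_prop)
    exact this.continuousOn.congr fun q hq => if_pos hq
  · have hc : Continuous fun q : (K × (S × I)) × I => D.h (σ (r q.1.2).2 * tent q.2, (r q.1.2).1) := by
      have := continuous_tent
      fun_prop
    exact hc.continuousOn.congr fun q hq => (h q.1.1).cylinderHomotopy_of_mem hq q.2

end Families

variable (D)

/-- The homotopy from `f` to `g` relative to `P`. -/
noncomputable def relHomotopy (r : C(S × I, S × I)) (f g : FixMap P) (s : S) (u : I) : S :=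
  -- The path follows three sides of the square of pairs `(v, u)`: up at `u = 0`, across at `v = 1`,
  -- down at `u = 1`. On them `σ v * tent u = 0`, so over `P` nothing moves.
  concat₃ (fun v => D.cylinderHomotopy f g (r (s, v)) 0)
    (fun v => D.cylinderHomotopy f g (r (s, 1)) v)
    (fun v => D.cylinderHomotopy f g (r (s, σ v)) 1) u

variable {D} {r : C(S × I, S × I)}

lemma relHomotopy_zero (hr : ∀ s, r (s, 0) = (s, 0)) (f g : FixMap P) (s : S) :
    D.relHomotopy r f g s 0 = f s := by
  rw [relHomotopy, concat₃_zero, hr, cylinderHomotopy_zero, rough_zero]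

lemma relHomotopy_one (hr : ∀ s, r (s, 0) = (s, 0)) (f g : FixMap P) (s : S) :
    D.relHomotopy r f g s 1 = g s := by
  rw [relHomotopy, concat₃_one, unitInterval.symm_one, hr, cylinderHomotopy_zero, rough_one]

lemma Matches.relHomotopy_of_mem {f g : FixMap P} (h : D.Matches f g)
    (hr : ∀ s ∈ P, ∀ t, r (s, t) = (s, t)) {s : S} (hs : s ∈ P) (u : I) :
    D.relHomotopy r f g s u = s := by
  have key : ∀ v w : I, σ v * tent w = 0 → D.cylinderHomotopy f g (r (s, v)) w = s := by
    intro v w hvw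
    rw [hr s hs, h.cylinderHomotopy_of_mem hs, hvw, h_zero]
  rw [relHomotopy]
  simp only [key _ 0 (by rw [tent_zero, mul_zero]), key _ 1 (by rw [tent_one, mul_zero]),
    key 1 _ (by rw [unitInterval.symm_one, zero_mul])]
  exact concat₃_const s u

lemma continuous_relHomotopy [DiscreteTopology C] {K : Type*} [TopologicalSpace K]
    {f g : K → FixMap P} (hf : Continuous fun q : K × S => f q.1 q.2)
    (hg : Continuous fun q : K × S => g q.1 q.2) (h : ∀ k, D.Matches (f k) (g k))
    (hP : IsClosed P) (hr : ∀ z, (r z).2 = 0 ∨ (r z).1 ∈ P) :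
    Continuous fun q : (K × S) × I => D.relHomotopy r (f q.1.1) (g q.1.1) q.1.2 q.2 := by
  have hc := continuous_cylinderHomotopy hf hg h hP hr
  refine continuous_concat₃
    (a := fun (q : K × S) v => D.cylinderHomotopy (f q.1) (g q.1) (r (q.2, v)) 0)
    (b := fun (q : K × S) v => D.cylinderHomotopy (f q.1) (g q.1) (r (q.2, 1)) v)
    (c := fun (q : K × S) v => D.cylinderHomotopy (f q.1) (g q.1) (r (q.2, σ v)) 1)
    ?_ ?_ ?_ (fun q => rfl) fun q => by simp
  · exact hc.comp (f := fun q : (K × S) × I => ((q.1.1, (q.1.2, q.2)), 0)) (by fun_prop)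
  · exact hc.comp (f := fun q : (K × S) × I => ((q.1.1, (q.1.2, 1)), q.2)) (by fun_prop)
  · exact hc.comp (f := fun q : (K × S) × I => ((q.1.1, (q.1.2, σ q.2)), 1)) (by fun_prop)

end Domination

/-! ### From a deformation to contractible components. -/

section Deformation

variable {Z : Type*} [TopologicalSpace Z]

/-- A space that deforms onto the values of a locally constant map has contractible path components,
and these form a discrete space to which it is homotopy equivalent. -/
theorem contractible_components_of_deformation (H : C(Z × I, Z)) (hH0 : ∀ z, H (z, 0) = z)
    (hH1 : IsLocallyConstant fun z => H (z, 1)) :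
    (∀ z : Z, ContractibleSpace (pathComponent z)) ∧ DiscreteTopology (ZerothHomotopy Z) ∧
      ∃ e : Z ≃ₕ ZerothHomotopy Z, ∀ z, e.toFun z = ZerothHomotopy.mk z := by
  have hjoin (z : Z) (t : I) : Joined z (H (z, t)) :=
    ⟨⟨⟨fun u => H (z, u * t), by fun_prop⟩, by simp [hH0], by simp⟩⟩
  have hconst {x y : Z} (h : Joined x y) : H (x, 1) = H (y, 1) := by
    obtain ⟨γ⟩ := h
    have := (hH1.comp_continuous γ.continuous).apply_eq_of_isPreconnected
      isPreconnected_univ (Set.mem_univ 0) (Set.mem_univ 1)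
    simpa using this
  have hdisc : DiscreteTopology (ZerothHomotopy Z) := by
    refine discreteTopology_iff_isOpen_singleton.mpr fun c => ?_
    obtain ⟨x, rfl⟩ := ZerothHomotopy.mk_surjective c
    rw [← ZerothHomotopy.isQuotientMap_mk.isOpen_preimage,
      ZerothHomotopy.preimage_singleton_eq_pathComponent]
    -- The path components are the fibres of the locally constant map `H (·, 1)`, hence open.
    convert hH1.isOpen_fiber (H (x, 1)) using 1
    ext y
    refine ⟨fun h => (hconst h).symm, fun h : H (y, 1) = H (x, 1) => ?_⟩
    exact (hjoin x 1).trans (h ▸ (hjoin y 1).symm)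
  refine ⟨fun z => ?_, hdisc, ?_⟩
  · rw [contractible_iff_id_nullhomotopic]
    refine ⟨⟨H (z, 1), hjoin z 1⟩, ⟨⟨⟨fun q => ⟨H (q.2.1, q.1), ?_⟩, ?_⟩, fun x => ?_, fun x => ?_⟩⟩⟩
    · exact q.2.2.trans (hjoin q.2.1 q.1)
    · exact Continuous.subtype_mk (by fun_prop) _
    · exact Subtype.ext (hH0 x.1)
    · exact Subtype.ext (hconst x.2).symm
  · refine ⟨⟨⟨ZerothHomotopy.mk, ZerothHomotopy.isQuotientMap_mk.continuous⟩,
      ⟨ZerothHomotopy.lift (fun z => H (z, 1)) fun _ _ h => hconst ⟨h⟩, continuous_of_discreteTopology⟩,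
      ?_, ?_⟩, fun _ => rfl⟩
    · refine ContinuousMap.Homotopic.symm ⟨⟨⟨fun q => H (q.2, q.1), by fun_prop⟩, fun x => ?_, fun x => rfl⟩⟩
      exact hH0 x
    · convert ContinuousMap.Homotopic.refl _
      ext c
      obtain ⟨x, rfl⟩ := ZerothHomotopy.mk_surjective c
      exact ZerothHomotopy.sound (hjoin x 1).somePath

end Deformation

lemma IsHomotopyEquiv.of_homotopic {X Y : Type u} [TopologicalSpace X] [TopologicalSpace Y]
    {f g : C(X, Y)} (hf : IsHomotopyEquiv f) (h : f.Homotopic g) : IsHomotopyEquiv g := by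
  obtain ⟨e, rfl⟩ := hf
  exact ⟨⟨g, e.invFun, (ContinuousMap.Homotopic.comp (.refl e.invFun) h.symm).trans e.left_inv,
    (ContinuousMap.Homotopic.comp h.symm (.refl e.invFun)).trans e.right_inv⟩, rfl⟩

/-! ### The k-topology of the homotopy automorphism monoid. -/

section HAutTopology

variable {X Y S : Type u} [TopologicalSpace X] [TopologicalSpace Y] [TopologicalSpace S]
  {c : Cobordism X Y S}

namespace HAut

/-- The identity map from the subspace of the mapping space. -/
def of (f : hAutSet c) : HAut c := f

lemma continuous_of_comp {K : Type u} [TopologicalSpace K] [CompactSpace K] [T2Space K]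
    {k : K → hAutSet c} (hk : Continuous k) : Continuous fun x => of (k x) := by
  let i₀ : (K : CompHaus.{u}) × C(K, hAutSet c) := ⟨CompHaus.of K, ⟨k, hk⟩⟩
  have h : Continuous fun x : K =>
      (⟨i₀, x⟩ : Σ i : (K : CompHaus.{u}) × C(K, hAutSet c), i.1) :=
    @continuous_sigmaMk _ (fun i : (K : CompHaus.{u}) × C(K, hAutSet c) => i.1) _ i₀
  have h' : Continuous fun x : Σ i : (K : CompHaus.{u}) × C(K, hAutSet c), i.1 =>
      of (x.1.2 x.2) := continuous_iff_coinduced_le.mpr le_rfl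
  exact h'.comp h

lemma continuous_of_comp_of {Z : Type*} [TopologicalSpace Z] {f : HAut c → Z}
    (h : ∀ (K : Type u) [TopologicalSpace K] [CompactSpace K] [T2Space K] (k : K → hAutSet c),
      Continuous k → Continuous fun x => f (of (k x))) : Continuous f :=
  continuous_from_compactlyGenerated (X := hAutSet c) f fun K g => h K g g.continuous

instance : CompactlyGeneratedSpace (HAut c) :=
  compactlyGeneratedSpace_of_continuous_maps fun _ hf =>
    continuous_of_comp_of fun K _ _ _ _ hk => hf K _ (continuous_of_comp hk)

lemma continuous_val : Continuous fun g : HAut c => (g.1 : C(S, S)) :=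
  continuous_of_comp_of fun _ _ _ _ _ hk => continuous_subtype_val.comp hk

lemma continuous_uncurry {K : Type u} [TopologicalSpace K] [CompactSpace K] [T2Space K]
    {k : K → HAut c} (hk : Continuous k) : Continuous fun q : K × S => (k q.1).1 q.2 :=
  have := c.isHGraph_total.1
  continuous_eval_of_compactlyGenerated (continuous_val.comp hk)

/-- Continuity into the monoid becomes joint continuity over compact test spaces, the form in which
the homotopies above are continuous. -/
lemma continuous_of_uncurry {Z : Type u} [TopologicalSpace Z] [CompactlyGeneratedSpace Z]
    {Φ : Z → HAut c} (h : ∀ (K : Type u) [TopologicalSpace K] [CompactSpace K] [T2Space K]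
      (k : K → Z), Continuous k → Continuous fun q : K × S => (Φ (k q.1)).1 q.2) :
    Continuous Φ := by
  refine continuous_from_compactlyGeneratedSpace _ fun K _ _ _ k hk => ?_
  have h1 : Continuous fun x => (Φ (k x)).1 :=
    ContinuousMap.continuous_of_continuous_uncurry _ (h K k hk)
  exact continuous_of_comp (k := fun x => ⟨(Φ (k x)).1, (Φ (k x)).2⟩) (h1.subtype_mk _)

/-- An element of the homotopy automorphism monoid as a map that fixes the ends pointwise. -/
def toFixMap (g : HAut c) : FixMap (Set.range (sumMap c.i c.j)) :=
  ⟨g.1, by rintro _ ⟨z, rfl⟩; exact g.2.2 z⟩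

end HAut

end HAutTopology

/-! ### The deformation of the homotopy automorphism monoid. -/

section Main

variable {X Y S : Type u} [TopologicalSpace X] [TopologicalSpace Y] [TopologicalSpace S]
  (c : Cobordism X Y S)

lemma Cobordism.exists_domination
    (hmeets : ∀ s : S, ∃ z : X ⊕ Y, Joined s (sumMap c.i c.j z)) :
    ∃ (α : Type u) (_ : DecidableEq α) (_ : Finite α) (C : Type u) (_ : TopologicalSpace C)
      (_ : DiscreteTopology C) (_ : Finite C),
      Nonempty (Domination (FreeGroup α) (FreeTree α) (Rose α) C (Set.range (sumMap c.i c.j))) := by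
  obtain ⟨α, _, _, ⟨a⟩, C, _, _, _, φ, l, ψ, ⟨h⟩⟩ := c.isHGraph_total.exists_domination
  refine ⟨α, inferInstance, inferInstance, C, inferInstance, inferInstance, inferInstance, ?_⟩
  let x₀ : FreeTree α := FreeTree.edge 1 a 0
  choose z hz using fun k : C => hmeets (ψ (k, Rose.proj x₀))
  choose y hy using fun k : C =>
    (Rose.isCombedCover (α := α)).surjective (φ (sumMap c.i c.j (z k)))
  exact ⟨{
    p := Rose.proj
    comb := Tree.comb
    cover := Rose.isCombedCover
    φ := φ
    l := l
    ψ := ψ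
    h := h
    x₀ := x₀
    z := fun k => sumMap c.i c.j (z k)
    z_mem := fun k => ⟨z k, rfl⟩
    δ := fun k => (hz k).symm.somePath
    y := y
    p_y := hy
    meets := fun s => by
      obtain ⟨w, hw⟩ := hmeets s
      exact ⟨_, ⟨w, rfl⟩, hw⟩ }⟩

lemma Cobordism.exists_finite_joinedIn : ∃ Q : Set (X ⊕ Y), Q.Finite ∧
    ∀ s ∈ Set.range (sumMap c.i c.j), ∃ q ∈ Q,
      JoinedIn (Set.range (sumMap c.i c.j)) s (sumMap c.i c.j q) := by
  obtain ⟨A, hA, hA'⟩ := c.isHGraph_source.exists_finite_joined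
  obtain ⟨B, hB, hB'⟩ := c.isHGraph_target.exists_finite_joined
  have key {x y : X ⊕ Y} (h : Joined x y) :
      JoinedIn (Set.range (sumMap c.i c.j)) (sumMap c.i c.j x) (sumMap c.i c.j y) := by
    obtain ⟨γ⟩ := h
    exact ⟨γ.map (sumMap c.i c.j).continuous, fun t => ⟨γ t, rfl⟩⟩
  refine ⟨Sum.inl '' A ∪ Sum.inr '' B, (hA.image _).union (hB.image _), ?_⟩
  rintro _ ⟨x | y, rfl⟩
  · obtain ⟨a, ha, h⟩ := hA' x
    exact ⟨_, Or.inl ⟨a, ha, rfl⟩, key (h.symm.map continuous_inl)⟩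
  · obtain ⟨b, hb, h⟩ := hB' y
    exact ⟨_, Or.inr ⟨b, hb, rfl⟩, key (h.symm.map continuous_inr)⟩

/-- A locally constant choice of homotopy automorphisms, such that each homotopy automorphism
matches its choice. -/
lemma Cobordism.exists_matching_choice
    {α : Type u} [DecidableEq α] [Finite α] {C : Type u} [TopologicalSpace C] [DiscreteTopology C]
    [Finite C]
    (D : Domination (FreeGroup α) (FreeTree α) (Rose α) C (Set.range (sumMap c.i c.j))) :
    ∃ rep : HAut c → HAut c, IsLocallyConstant rep ∧
      ∀ g, D.Matches g.toFixMap (rep g).toFixMap := by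
  obtain ⟨Q, hQ, hQ'⟩ := c.exists_finite_joinedIn
  have : Finite Q := hQ
  let q : Q → D.Pullback := fun j => D.pt (sumMap c.i c.j j)
  have hq : ∀ j, (q j).1.1 ∈ Set.range (sumMap c.i c.j) := fun j => ⟨j, rfl⟩
  have hP : ∀ s ∈ Set.range (sumMap c.i c.j), ∃ j,
      JoinedIn (Set.range (sumMap c.i c.j)) s (q j).1.1 := fun s hs => by
    obtain ⟨j, hj, h⟩ := hQ' s hs
    exact ⟨⟨j, hj⟩, h⟩
  have hgen : Subgroup.closure (Set.range (FreeGroup.of (α := α))) = ⊤ :=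
    FreeGroup.closure_range_of α
  let Inv : HAut c → _ := fun g => D.invariant FreeGroup.of q g.toFixMap
  have hInv : IsLocallyConstant Inv := by
    -- With the discrete topology local constancy is continuity, which may be tested on compact
    -- spaces.
    let _ : TopologicalSpace ((C × α → FreeGroup α) × (Q → FreeGroup α)) := ⊥
    have : DiscreteTopology ((C × α → FreeGroup α) × (Q → FreeGroup α)) := ⟨rfl⟩
    rw [IsLocallyConstant.iff_continuous]
    refine continuous_from_compactlyGeneratedSpace _ fun K _ _ _ k hk => ?_
    exact (D.isLocallyConstant_invariant FreeGroup.of hq (g := fun x => (k x).toFixMap)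
      (HAut.continuous_uncurry hk)).continuous
  have : Nonempty (HAut c) := ⟨1⟩
  -- The representative depends on `g` only through the invariant, so it is locally constant too.
  have hrep (g : HAut c) : Inv g = Inv (Function.invFun Inv (Inv g)) :=
    (Function.invFun_eq ⟨g, rfl⟩).symm
  exact ⟨fun g => Function.invFun Inv (Inv g), hInv.comp (Function.invFun Inv), fun g =>
    ⟨D.holonomy_eq_of_invariant hgen (hrep g), fun x hx => D.lift_eq_of_invariant hgen hq hP (hrep g) hx⟩⟩

/-- The homotopy automorphism monoid deforms onto the values of a locally constant map. -/
theorem Cobordism.exists_deformation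
    (hmeets : ∀ s : S, ∃ z : X ⊕ Y, Joined s (sumMap c.i c.j z)) :
    ∃ H : C(HAut c × I, HAut c), (∀ g, H (g, 0) = g) ∧ IsLocallyConstant fun g => H (g, 1) := by
  have := c.isHGraph_total.1
  obtain ⟨α, _, _, C, _, _, _, ⟨D⟩⟩ := c.exists_domination hmeets
  obtain ⟨rep, hrep, hmatch⟩ := c.exists_matching_choice D
  obtain ⟨r, hr0, hrP, hr⟩ := c.isClosedCofibration.exists_retraction
  have hrP' : ∀ s ∈ Set.range (sumMap c.i c.j), ∀ t, r (s, t) = (s, t) := by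
    rintro _ ⟨z, rfl⟩ t
    exact hrP z t
  have hclosed := c.isClosedCofibration.1.isClosed_range
  let G (g : HAut c) (s : S) (t : I) : S := D.relHomotopy r g.toFixMap (rep g).toFixMap s t
  have hG1 (g : HAut c) : Continuous fun q : S × I => G g q.1 q.2 :=
    (Domination.continuous_relHomotopy (K := PUnit.{1}) (Domination.continuous_const_family g.toFixMap)
      (Domination.continuous_const_family (rep g).toFixMap) (fun _ => hmatch g) hclosed hr).comp
      (f := fun q : S × I => ((PUnit.unit, q.1), q.2)) (by fun_prop)
  let Φ (q : HAut c × I) : HAut c := ⟨⟨fun s => G q.1 s q.2, by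
      exact (hG1 q.1).comp (Continuous.prodMk_left q.2)⟩, by
    -- Each stage is homotopic to the given equivalence along the earlier part of the deformation,
    -- so it stays in the monoid.
    refine ⟨IsHomotopyEquiv.of_homotopic q.1.2.1
      ⟨⟨⟨fun x => G q.1 x.2 (x.1 * q.2), ?_⟩, fun s => ?_, fun s => ?_⟩⟩, fun z => ?_⟩
    · exact (hG1 q.1).comp (f := fun x : I × S => (x.2, x.1 * q.2)) (by fun_prop)
    · simp only [zero_mul]
      exact Domination.relHomotopy_zero hr0 _ _ s
    · simp
    · exact (hmatch q.1).relHomotopy_of_mem hrP' ⟨z, rfl⟩ q.2⟩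
  have hΦ0 (g : HAut c) : Φ (g, 0) = g :=
    Subtype.ext (ContinuousMap.ext fun s => Domination.relHomotopy_zero hr0 _ _ s)
  have hΦ1 (g : HAut c) : Φ (g, 1) = rep g :=
    Subtype.ext (ContinuousMap.ext fun s => Domination.relHomotopy_one hr0 _ _ s)
  refine ⟨⟨Φ, HAut.continuous_of_uncurry fun K _ _ _ k hk => ?_⟩, hΦ0, ?_⟩
  · have h1 : Continuous fun x => (k x).1 := hk.fst
    exact (Domination.continuous_relHomotopy (f := fun x => (k x).1.toFixMap)
      (g := fun x => (rep (k x).1).toFixMap) (HAut.continuous_uncurry h1)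
      (HAut.continuous_uncurry (hrep.continuous.comp h1)) (fun x => hmatch _) hclosed hr).comp
      (f := fun q : K × S => (q, (k q.1).2)) (by fun_prop)
  · simpa only [ContinuousMap.coe_mk, hΦ1] using hrep

end Main

end HGraph

theorem mainTheorem7 {X Y S : Type u} [TopologicalSpace X] [TopologicalSpace Y]
    [TopologicalSpace S] (S₀ : HGraph.Cobordism X Y S)
    (hmeets : ∀ s : S, ∃ z : X ⊕ Y, Joined s (HGraph.sumMap S₀.i S₀.j z)) :
    (∀ f : HGraph.HAut S₀, ContractibleSpace (pathComponent f)) ∧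
    DiscreteTopology (ZerothHomotopy (HGraph.HAut S₀)) ∧
    ∃ e : HGraph.HAut S₀ ≃ₕ ZerothHomotopy (HGraph.HAut S₀),
      ∀ f, e.toFun f = ZerothHomotopy.mk f := by
  obtain ⟨H, hH0, hH1⟩ := S₀.exists_deformation hmeets
  exact HGraph.contractible_components_of_deformation H hH0 hH1
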